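/- Let $X$ be a complex manifold of dimension $n$, let $(E,h)$ be a holomorphic vector bundle of finite rank on $X$ with a smooth Hermitian metric, and let $\nabla=\nabla'+\bar\partial$ be its Chern connection ($\nabla'$ the $(1,0)$-part), acting on the space $A^{\bullet,\bullet}(X,E)=\bigoplus_{p,q}A^{p,q}(X,E)$ of smooth $E$-valued forms. Let $\phi=\sum_i\phi^i\otimes\partial_i\in A^{0,1}(X,T^{1,0}_X)$ be a Beltrami differential. For $\psi=\sum_i\psi^i\otimes\partial_i\in A^{0,s}(X,T^{1,0}_X)$ let $i_\psi\sigma=\psi\lrcorner\sigma=\sum_i\psi^i\wedge(\partial_i\lrcorner\sigma)$ be the contraction, and set $$e^{\pm i_\phi}=\sum_{m\ge 0}\frac{(\pm i_\phi)^m}{m!}\ \text{(a finite sum)},\qquad [\phi,\phi]=2\sum_{i,j}(\phi^i\wedge\partial_i\phi^j)\otimes\partial_j,$$ $$\mathcal L_\phi=-\nabla\circ i_\phi+i_\phi\circ\nabla,\qquad \mathcal L^{1,0}_\phi=-\nabla'\circ i_\phi+i_\phi\circ\nabla',\qquad \mathcal L^{0,1}_\phi=-\bar\partial\circ i_\phi+i_\phi\circ\bar\partial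 .$$ Then on $A^{\bullet,\bullet}(X,E)$ $$e^{-i_\phi}\circ\nabla\circ e^{i_\phi}=\nabla-\mathcal L_\phi-i_{\frac12[\phi,\phi]}=\nabla-\mathcal L^{1,0}_\phi+i_{\bar\partial\phi-\frac12[\phi,\phi]},$$ $$e^{-i_\phi}\circ\bar\partial\circ e^{i_\phi}=\bar\partial-\mathcal L^{0,1}_\phi,\qquad e^{-i_\phi}\circ\nabla'\circ e^{i_\phi}=\nabla'-\mathcal L^{1,0}_\phi-i_{\frac12[\phi,\phi]},$$ and, if $\bar\partial\phi=\frac12[\phi,\phi]$, $$\bar\partial-\mathcal L^{1,0}_\phi=e^{-i_\phi}\circ(\bar\partial-\mathcal L_\phi)\circ e^{i_\phi}.$$ Moreover, for every $q$ and every $\sigma\in A^{n,q}(X,E)$, $$(e^{-i_\phi}\circ\nabla\circ e^{i_\phi})(\sigma)=\bar\partial\sigma-\mathcal L^{1,0}_\phi\sigma+i_{\bar\partial\phi-\frac12[\phi,\phi]}\sigma=\bar\partial\sigma+\nabla'(\phi\lrcorner\sigma)+\Bigl(\bar\partial\phi-\frac12[\phi,\phi]\Bigr)\lrcorner\sigma,$$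 so that, if $\phi$ is integrable, i.e. $\bar\partial\phi-\frac12[\phi,\phi]=0$, $$(e^{-i_\phi}\circ\nabla\circ e^{i_\phi})(\sigma)=\bar\partial\sigma+\nabla'(\phi\lrcorner\sigma).$$ -/

import Mathlib

open scoped Manifold ContDiff

noncomputable section

namespace CpxForms

open ContinuousAlternatingMap

/-! ### Multilinear algebra on one complex vector space

`V` plays the role of a holomorphic tangent space `T_x X`, regarded also as a real vector space.
Complex-valued (or `G`-valued) real-multilinear alternating maps on `V` are the `k`-covectors
`Λ^k (T_x X)^* ⊗ G`. The space `T^{1,0}_x X` is identified with `V`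
by `u ↦ (u - i J u) / 2`, so that `∂/∂z^i` corresponds to the `i`-th coordinate vector. -/

section Algebra

variable {V : Type*} [NormedAddCommGroup V] [NormedSpace ℂ V]
variable {G : Type*} [NormedAddCommGroup G] [NormedSpace ℝ G] [NormedSpace ℂ G]
  [SMulCommClass ℝ ℂ G]

/-- Multiplication by the imaginary unit on `V`. -/
def mulI (V : Type*) [NormedAddCommGroup V] [NormedSpace ℂ V] : V →L[ℝ] V :=
  (Complex.I • ContinuousLinearMap.id ℂ V).restrictScalars ℝ

/-- The complex-linear part `v ↦ (f v - i f (i v)) / 2` of a real-linear map `f`. It is the value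
of the complex-linear extension of `f` at the `(1,0)`-vector belonging to `v`. In particular the
complex-linear part of a differential `Df` is `v ↦ ∑ v^i ∂f/∂z^i`. -/
def linPart (f : V →L[ℝ] G) : V →L[ℝ] G :=
  (1 / 2 : ℂ) • (f - Complex.I • f.comp (mulI V))

/-- The conjugate-linear part `v ↦ (f v + i f (i v)) / 2` of a real-linear map `f`. In particular
the conjugate-linear part of a differential `Df` is `v ↦ ∑ conj(v^i) ∂f/∂(z^i)bar`. -/
def antiPart (f : V →L[ℝ] G) : V →L[ℝ] G :=
  (1 / 2 : ℂ) • (f + Complex.I • f.comp (mulI V))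

/-- A covector of bidegree `(p, q)`: `α (c v₁, …, c v_k) = c ^ p * conj c ^ q * α (v₁, …, v_k)`
for all complex numbers `c`. -/
def IsOfType {k : ℕ} (p q : ℕ) (α : V [⋀^Fin k]→L[ℝ] G) : Prop :=
  ∀ (c : ℂ) (v : Fin k → V),
    α (fun i => c • v i) = (c ^ p * (starRingEnd ℂ c) ^ q) • α v

/-- The identification of one-covectors with values in `V` with real-linear maps `V → V`. -/
def asLinearMap : (V [⋀^Fin 1]→L[ℝ] V) →L[ℝ] (V →L[ℝ] V) :=
  (ofSubsingletonLIE (𝕜 := ℝ) (E := V) (F := V) (0 : Fin 1)).symm.toContinuousLinearEquiv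

/-- For `φ = ∑ φ^i ⊗ ∂_i` with one-covectors `φ^i` and a linear family `K` of `k`-covectors,
`K_i = K ∂_i`, this is `∑ φ^i ∧ K_i`. -/
def wedgeOne {k : ℕ} (φ : V [⋀^Fin 1]→L[ℝ] V) (K : V →L[ℝ] (V [⋀^Fin k]→L[ℝ] G)) :
    V [⋀^Fin (k + 1)]→L[ℝ] G :=
  alternatizeUncurryFin (K.comp (asLinearMap φ))

/-- For `ψ = ∑ ψ^i ⊗ ∂_i` with two-covectors `ψ^i` and a linear family `K` of `k`-covectors,
`K_i = K ∂_i`, this is `∑ ψ^i ∧ K_i`. (Alternating over the two arguments of `ψ` one after the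
other counts each pair of arguments twice.) -/
def wedgeTwo {k : ℕ} (ψ : V [⋀^Fin 2]→L[ℝ] V) (K : V →L[ℝ] (V [⋀^Fin k]→L[ℝ] G)) :
    V [⋀^Fin (k + 2)]→L[ℝ] G :=
  (1 / 2 : ℝ) • alternatizeUncurryFin
    ((alternatizeUncurryFinCLM ℝ V G).comp
      ((ContinuousLinearMap.compL ℝ V V (V [⋀^Fin k]→L[ℝ] G) K).comp
        (asLinearMap.comp ψ.curryLeft)))

/-- The contraction `i_φ α = ∑ φ^i ∧ (∂_i ⌟ α)` with a `T^{1,0}`-valued one-covector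
`φ = ∑ φ^i ⊗ ∂_i`. -/
def contractOne (φ : V [⋀^Fin 1]→L[ℝ] V) :
    {k : ℕ} → (V [⋀^Fin k]→L[ℝ] G) → (V [⋀^Fin k]→L[ℝ] G)
  | 0, _ => 0
  | _ + 1, α => wedgeOne φ (linPart α.curryLeft)

/-- The contraction `i_ψ α = ∑ ψ^i ∧ (∂_i ⌟ α)` with a `T^{1,0}`-valued two-covector
`ψ = ∑ ψ^i ⊗ ∂_i`. -/
def contractTwo (ψ : V [⋀^Fin 2]→L[ℝ] V) :
    {k : ℕ} → (V [⋀^Fin k]→L[ℝ] G) → (V [⋀^Fin (k + 1)]→L[ℝ] G)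
  | 0, _ => 0
  | _ + 1, α => wedgeTwo ψ (linPart α.curryLeft)

end Algebra

/-- The exponential series `∑_m T^m / m!` of an operator that is nilpotent at each vector
(so that the sum is finite). -/
def expOp {W : Type*} [AddCommGroup W] [Module ℂ W] (T : W → W) (w : W) : W :=
  ∑ᶠ m : ℕ, ((Nat.factorial m : ℂ)⁻¹) • (T^[m] w)

/-! ### Forms on a complex manifold

`X` is a complex manifold modelled on `V`. As in Mathlib, the tangent space at `x` *is* the vector
space `V`, a tangent vector being represented by its coordinates in the preferred chart at `x`; the
map `tangentCoordChange 𝓘(ℂ, V) x y z` passes from the coordinates of the chart at `x` to those of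
the chart at `y`, for tangent vectors at `z`.
The bundle `E` is a holomorphic vector bundle with fibre `F`; its Hermitian metric is
the inner product of the fibres. -/

section Manifold

variable {V : Type*} [NormedAddCommGroup V] [NormedSpace ℂ V]
variable {X : Type*} [TopologicalSpace X] [ChartedSpace V X] [IsManifold 𝓘(ℂ, V) ω X]

/-- `T^{1,0}`-valued `s`-forms on `X` (no smoothness, no type). -/
abbrev TForm (V X : Type*) [NormedAddCommGroup V] [NormedSpace ℂ V] (s : ℕ) :=
  X → (V [⋀^Fin s]→L[ℝ] V)

/-- `E`-valued `k`-forms on `X` (no smoothness). -/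
abbrev EForm (V : Type*) [NormedAddCommGroup V] [NormedSpace ℂ V] {X : Type*} (E : X → Type*)
    [∀ x, NormedAddCommGroup (E x)] [∀ x, InnerProductSpace ℂ (E x)] (k : ℕ) :=
  (x : X) → (V [⋀^Fin k]→L[ℝ] E x)

/-- The point of `X` with coordinate `z` in the chart at `x₀`. -/
def pt (x₀ : X) (z : V) : X := (extChartAt 𝓘(ℂ, V) x₀).symm z

/-- A `T^{1,0}`-valued form in the holomorphic coordinates of the chart at `x₀`. -/
def coordT (x₀ : X) {s : ℕ} (φ : TForm V X s) (z : V) : V [⋀^Fin s]→L[ℝ] V :=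
  ((tangentCoordChange 𝓘(ℂ, V) (pt x₀ z) x₀ (pt x₀ z)).restrictScalars ℝ).compContinuousAlternatingMap
    ((φ (pt x₀ z)).compContinuousLinearMap
      ((tangentCoordChange 𝓘(ℂ, V) x₀ (pt x₀ z) (pt x₀ z)).restrictScalars ℝ))

/-- `φ ∈ A^{0,s}(X, T^{1,0}_X)`: a smooth `T^{1,0}`-valued form of type `(0,s)`. -/
def IsSmoothT {s : ℕ} (φ : TForm V X s) : Prop :=
  (∀ x, IsOfType 0 s (φ x)) ∧
    ∀ x₀ : X, ContDiffOn ℝ ∞ (coordT x₀ φ) (extChartAt 𝓘(ℂ, V) x₀).target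

/-- `∂̄φ`, computed at each point in holomorphic coordinates: `∑_j d(z^j)bar ∧ ∂φ/∂(z^j)bar`. -/
def dbarT {s : ℕ} (φ : TForm V X s) : TForm V X (s + 1) := fun x =>
  alternatizeUncurryFin (antiPart (fderiv ℝ (coordT x φ) (extChartAt 𝓘(ℂ, V) x x)))

/-- The bracket `[φ, ψ] = ∑ (φ^i ∧ ∂_i ψ^j + ψ^i ∧ ∂_i φ^j) ⊗ ∂_j` of two elements of
`A^{0,1}(X, T^{1,0}_X)`, computed at each point in holomorphic coordinates. -/
def bracket (φ ψ : TForm V X 1) : TForm V X 2 := fun x =>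
  wedgeOne (φ x) (linPart (fderiv ℝ (coordT x ψ) (extChartAt 𝓘(ℂ, V) x x))) +
    wedgeOne (ψ x) (linPart (fderiv ℝ (coordT x φ) (extChartAt 𝓘(ℂ, V) x x)))

variable {E : X → Type*} [∀ x, NormedAddCommGroup (E x)] [∀ x, InnerProductSpace ℂ (E x)]

/-- The contraction `i_φ σ = φ ⌟ σ` with a `T^{1,0}`-valued one-form. -/
def contract (φ : TForm V X 1) {k : ℕ} (σ : EForm V E k) : EForm V E k :=
  fun x => contractOne (φ x) (σ x)

/-- The contraction `i_ψ σ = ψ ⌟ σ` with a `T^{1,0}`-valued two-form. -/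
def contractT2 (ψ : TForm V X 2) {k : ℕ} (σ : EForm V E k) : EForm V E (k + 1) :=
  fun x => contractTwo (ψ x) (σ x)

/-- `e^{i_φ} = ∑_m i_φ^m / m!`. -/
def expContract (φ : TForm V X 1) {k : ℕ} (σ : EForm V E k) : EForm V E k :=
  expOp (fun τ : EForm V E k => contract φ τ) σ

/-- `e^{-i_φ} = ∑_m (-i_φ)^m / m!`. -/
def expNegContract (φ : TForm V X 1) {k : ℕ} (σ : EForm V E k) : EForm V E k :=
  expOp (fun τ : EForm V E k => -contract φ τ) σ

variable (F : Type*) [NormedAddCommGroup F] [NormedSpace ℂ F]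
  [TopologicalSpace (Bundle.TotalSpace F E)] [FiberBundle F E] [VectorBundle ℂ F E]

/-- The image, in the chart at `x₀`, of the set where the chart and the trivialization at `x₀` are
both defined. -/
def coordDomain (E : X → Type*) [∀ x, NormedAddCommGroup (E x)]
    [TopologicalSpace (Bundle.TotalSpace F E)] [FiberBundle F E] (x₀ : X) : Set V :=
  {z | z ∈ (extChartAt 𝓘(ℂ, V) x₀).target ∧ pt x₀ z ∈ (trivializationAt F E x₀).baseSet}

/-- An `E`-valued form in the holomorphic coordinates of the chart at `x₀` and the holomorphic
frame given by the trivialization at `x₀`. -/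
def coordForm (x₀ : X) {k : ℕ} (σ : EForm V E k) (z : V) : V [⋀^Fin k]→L[ℝ] F :=
  (((trivializationAt F E x₀).continuousLinearMapAt ℂ
      (pt x₀ z)).restrictScalars ℝ).compContinuousAlternatingMap
    ((σ (pt x₀ z)).compContinuousLinearMap
      ((tangentCoordChange 𝓘(ℂ, V) x₀ (pt x₀ z) (pt x₀ z)).restrictScalars ℝ))

/-- A covector at `x` with values in `E x`, from its expression in the chart and the frame
at `x`. -/
def ofCoord (x : X) {k : ℕ} (η : V [⋀^Fin k]→L[ℝ] F) : V [⋀^Fin k]→L[ℝ] E x :=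
  (((trivializationAt F E x).symmL ℂ x).restrictScalars ℝ).compContinuousAlternatingMap η

/-- Smooth `E`-valued `k`-forms, i.e. the elements of `⨁_{p+q=k} A^{p,q}(X, E)`. -/
def IsSmoothForm {k : ℕ} (σ : EForm V E k) : Prop :=
  ∀ x₀ : X, ContDiffOn ℝ ∞ (coordForm F x₀ σ) (coordDomain F E x₀)

/-- `σ ∈ A^{p,q}(X, E)`. -/
def IsSmoothPQ {k : ℕ} (p q : ℕ) (σ : EForm V E k) : Prop :=
  IsSmoothForm F σ ∧ ∀ x, IsOfType p q (σ x)

/-- The Hermitian metric of `E` in the holomorphic frame at `x₀`, as the linear map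
`s ↦ (t ↦ h(s, t))`, where `h(s, t)` is linear in `s` and conjugate-linear in `t`. -/
def coordMetric (E : X → Type*) [∀ x, NormedAddCommGroup (E x)] [∀ x, InnerProductSpace ℂ (E x)]
    [TopologicalSpace (Bundle.TotalSpace F E)] [FiberBundle F E] [VectorBundle ℂ F E]
    (x₀ : X) (z : V) : F →L[ℂ] (F →L⋆[ℂ] ℂ) :=
  ((innerSL ℂ : E (pt x₀ z) →L⋆[ℂ] E (pt x₀ z) →L[ℂ] ℂ).flip).bilinearComp
    ((trivializationAt F E x₀).symmL ℂ (pt x₀ z)) ((trivializationAt F E x₀).symmL ℂ (pt x₀ z))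

/-- The Hermitian metric of `E` is smooth. -/
def IsSmoothMetric (V : Type*) [NormedAddCommGroup V] [NormedSpace ℂ V] {X : Type*}
    [TopologicalSpace X] [ChartedSpace V X] (F : Type*) [NormedAddCommGroup F] [NormedSpace ℂ F]
    (E : X → Type*) [∀ x, NormedAddCommGroup (E x)] [∀ x, InnerProductSpace ℂ (E x)]
    [TopologicalSpace (Bundle.TotalSpace F E)] [FiberBundle F E] [VectorBundle ℂ F E] : Prop :=
  ∀ x₀ : X, ContDiffOn ℝ ∞ (coordMetric (V := V) F E x₀) (coordDomain (V := V) F E x₀)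

/-- The connection form `θ = h⁻¹ ∂h` of the Chern connection in the holomorphic frame at `x₀`:
the `(1,0)`-form with `h (θ(v) s, t) = ∂_v h(s, t)` for constant `s`, `t`. -/
def chernForm (E : X → Type*) [∀ x, NormedAddCommGroup (E x)] [∀ x, InnerProductSpace ℂ (E x)]
    [TopologicalSpace (Bundle.TotalSpace F E)] [FiberBundle F E] [VectorBundle ℂ F E]
    (x₀ : X) (z : V) : V →L[ℝ] (F →L[ℂ] F) :=
  ((ContinuousLinearMap.compL ℂ F (F →L⋆[ℂ] ℂ) F
    (coordMetric F E x₀ z).inverse).restrictScalars ℝ).comp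
      (linPart (fderiv ℝ (coordMetric F E x₀) z))

/-- The covariant derivative `v ↦ D_v σ + θ(v) σ` of the components of an `E`-valued form in the
chart and the frame at `x`, at the point `x`. -/
def covDeriv (x : X) {k : ℕ} (σ : EForm V E k) : V →L[ℝ] (V [⋀^Fin k]→L[ℝ] F) :=
  fderiv ℝ (coordForm F x σ) (extChartAt 𝓘(ℂ, V) x x) +
    ((ContinuousLinearMap.compContinuousAlternatingMapCLM ℝ V F F (Fin k)).flip
      (coordForm F x σ (extChartAt 𝓘(ℂ, V) x x))).comp
      ((ContinuousLinearMap.restrictScalarsL ℂ F F ℝ ℝ).comp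
        (chernForm F E x (extChartAt 𝓘(ℂ, V) x x)))

/-- The Chern connection `∇`, acting on `E`-valued forms as `d + θ ∧` in holomorphic frames. -/
def nabla {k : ℕ} (σ : EForm V E k) : EForm V E (k + 1) := fun x =>
  ofCoord F x (alternatizeUncurryFin (covDeriv F x σ))

/-- The `(1,0)`-part `∇'` of the Chern connection, `∂ + θ ∧` in holomorphic frames. -/
def nablaPrime {k : ℕ} (σ : EForm V E k) : EForm V E (k + 1) := fun x =>
  ofCoord F x (alternatizeUncurryFin (linPart (covDeriv F x σ)))

/-- The operator `∂̄` of the holomorphic bundle `E`, acting on the components in holomorphic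
coordinates and frames. -/
def dbar {k : ℕ} (σ : EForm V E k) : EForm V E (k + 1) := fun x =>
  ofCoord F x (alternatizeUncurryFin
    (antiPart (fderiv ℝ (coordForm F x σ) (extChartAt 𝓘(ℂ, V) x x))))

/-- `𝓛_φ = -∇ ∘ i_φ + i_φ ∘ ∇`. -/
def lieD (φ : TForm V X 1) {k : ℕ} (σ : EForm V E k) : EForm V E (k + 1) :=
  -nabla F (contract φ σ) + contract φ (nabla F σ)

/-- `𝓛_φ^{1,0} = -∇' ∘ i_φ + i_φ ∘ ∇'`. -/
def lieD10 (φ : TForm V X 1) {k : ℕ} (σ : EForm V E k) : EForm V E (k + 1) :=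
  -nablaPrime F (contract φ σ) + contract φ (nablaPrime F σ)

/-- `𝓛_φ^{0,1} = -∂̄ ∘ i_φ + i_φ ∘ ∂̄`. -/
def lieD01 (φ : TForm V X 1) {k : ℕ} (σ : EForm V E k) : EForm V E (k + 1) :=
  -dbar F (contract φ σ) + contract φ (dbar F σ)

end Manifold

end CpxForms

end

open CpxForms

/-! Write `ad N = N ∘ i_φ - i_φ ∘ N`. Left composition with `-i_φ` and right composition with `i_φ`
commute and are nilpotent, so `e^{-i_φ} ∘ N ∘ e^{i_φ} = e^{ad} N`. If `ad³ N = 0`, only `N + ad N +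
½ ad² N` remains (`expOp_neg_comp_expOp`). Everything thus reduces to iterated commutators of `∂̄`
and `∇'` with `i_φ`.

These are computed pointwise. In a chart and a holomorphic frame, `∇σ` is the alternation of a
real-linear map `u ↦ ∇_u σ`; `∇'` and `∂̄` alternate its complex-linear and conjugate-linear parts.
Two facts drive the computation: the Leibniz rule for `∇_u (i_φ σ)` (`covDerivE_contract`), and the
fact that `i_φ` passes through an alternation up to a term `φ ∧ (·)` that sees only the
complex-linear part (`contractOne_alternatizeUncurryFin`). Hence `ad ∂̄ = i_{∂̄φ}` and `ad ∇' =
i_{∂φ} - φ ∧ ∇'`, where the last term stands for `∑ φ^i ∧ ∇'_i`. Since `φ` has type `(0,1)`,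
contractions with `T^{1,0}`-valued forms of type `(0,s)` commute (for `s = 1, 2`). So `ad² ∂̄ = 0`,
while `ad² ∇' = -i_{[φ,φ]}` and `ad³ ∇' = 0`.

Commutativity also makes `i_φ` nilpotent: on `k`-forms it is a sum of `k` commuting square-zero
operators, one for each slot.

In bidegree `(n,q)`, `∇'σ` would have type `(n+1,q)` and therefore vanishes (`IsUnitType.eq_zero`),
which turns `∇σ` into `∂̄σ` and `-𝓛^{1,0}_φ σ` into `∇'(φ ⌟ σ)`.

The differential operators are linear only on differentiable forms, so they are treated as maps from
smooth forms to all forms; the commutator uses `i_φ` on each side, and smoothness of `∇σ` is never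
needed. -/

noncomputable section

namespace CpxForms

open ContinuousAlternatingMap

set_option linter.unusedSectionVars false

/-! ### Complex-linear parts, contraction and alternation at one point -/

section Algebra

variable {V : Type*} [NormedAddCommGroup V] [NormedSpace ℂ V]
variable {G : Type*} [NormedAddCommGroup G] [NormedSpace ℝ G] [NormedSpace ℂ G]
  [SMulCommClass ℝ ℂ G]

theorem linPart_apply (f : V →L[ℝ] G) (v : V) :
    linPart f v = (1 / 2 : ℂ) • (f v - Complex.I • f (Complex.I • v)) := rfl

theorem antiPart_apply (f : V →L[ℝ] G) (v : V) :
    antiPart f v = (1 / 2 : ℂ) • (f v + Complex.I • f (Complex.I • v)) := rfl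

theorem linPart_add (f g : V →L[ℝ] G) : linPart (f + g) = linPart f + linPart g := by
  ext v; simp only [linPart_apply, _root_.add_apply]; module

theorem antiPart_add (f g : V →L[ℝ] G) : antiPart (f + g) = antiPart f + antiPart g := by
  ext v; simp only [antiPart_apply, _root_.add_apply]; module

theorem linPart_smul (c : ℂ) (f : V →L[ℝ] G) : linPart (c • f) = c • linPart f := by
  ext v; simp only [linPart_apply, _root_.smul_apply]; module

theorem antiPart_smul (c : ℂ) (f : V →L[ℝ] G) : antiPart (c • f) = c • antiPart f := by
  ext v; simp only [antiPart_apply, _root_.smul_apply]; module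

theorem linPart_add_antiPart (f : V →L[ℝ] G) : linPart f + antiPart f = f := by
  ext v; simp only [linPart_apply, antiPart_apply, _root_.add_apply]; module

theorem map_I_smul_I_smul (f : V →L[ℝ] G) (v : V) :
    f (Complex.I • Complex.I • v) = -f v := by
  rw [smul_smul, Complex.I_mul_I, neg_one_smul, map_neg]

theorem I_smul_I_smul (g : G) : Complex.I • Complex.I • g = -g := by
  rw [smul_smul, Complex.I_mul_I, neg_one_smul]

theorem linPart_I_smul (f : V →L[ℝ] G) (v : V) :
    linPart f (Complex.I • v) = Complex.I • linPart f v := by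
  simp only [linPart_apply, map_I_smul_I_smul]
  rw [smul_comm, smul_sub, smul_sub, I_smul_I_smul]; module

theorem antiPart_I_smul (f : V →L[ℝ] G) (v : V) :
    antiPart f (Complex.I • v) = -(Complex.I • antiPart f v) := by
  simp only [antiPart_apply, map_I_smul_I_smul]
  rw [smul_comm Complex.I, smul_add, smul_add, I_smul_I_smul]; module

theorem linPart_eq_self {f : V →L[ℝ] G} (hf : ∀ v, f (Complex.I • v) = Complex.I • f v) :
    linPart f = f := by
  ext v
  rw [linPart_apply, hf, I_smul_I_smul]; module

theorem linPart_eq_zero {f : V →L[ℝ] G} (hf : ∀ v, f (Complex.I • v) = -(Complex.I • f v)) :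
    linPart f = 0 := by
  ext v
  rw [linPart_apply, hf, smul_neg, I_smul_I_smul]; simp

theorem antiPart_eq_zero {f : V →L[ℝ] G} (hf : ∀ v, f (Complex.I • v) = Complex.I • f v) :
    antiPart f = 0 := by
  ext v
  rw [antiPart_apply, hf, I_smul_I_smul]; simp

theorem linPart_linPart (f : V →L[ℝ] G) : linPart (linPart f) = linPart f :=
  linPart_eq_self (linPart_I_smul f)

theorem linPart_antiPart (f : V →L[ℝ] G) : linPart (antiPart f) = 0 :=
  linPart_eq_zero (antiPart_I_smul f)

variable {H : Type*} [NormedAddCommGroup H] [NormedSpace ℝ H] [NormedSpace ℂ H]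
  [SMulCommClass ℝ ℂ H]

theorem linPart_comp (B : G →L[ℝ] H) (hB : ∀ (c : ℂ) g, B (c • g) = c • B g) (f : V →L[ℝ] G) :
    linPart (B.comp f) = B.comp (linPart f) := by
  ext v
  simp only [linPart_apply, ContinuousLinearMap.comp_apply, hB, map_sub]

theorem antiPart_comp (B : G →L[ℝ] H) (hB : ∀ (c : ℂ) g, B (c • g) = c • B g)
    (f : V →L[ℝ] G) : antiPart (B.comp f) = B.comp (antiPart f) := by
  ext v
  simp only [antiPart_apply, ContinuousLinearMap.comp_apply, hB, map_add]

theorem map_complex_smul_of_I [IsScalarTower ℝ ℂ G] (f : V →L[ℝ] G)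
    (hf : ∀ v, f (Complex.I • v) = Complex.I • f v)
    (c : ℂ) (v : V) : f (c • v) = c • f v := by
  have h : ∀ (r : ℝ) (g : G), (r : ℂ) • g = r • g := fun r g => algebraMap_smul ℂ r g
  conv_lhs => rw [← Complex.re_add_im c]
  conv_rhs => rw [← Complex.re_add_im c]
  simp only [add_smul, mul_smul, map_add, Complex.coe_smul, map_smul, hf, h]

theorem map_conj_smul_of_I [IsScalarTower ℝ ℂ G] (f : V →L[ℝ] G)
    (hf : ∀ v, f (Complex.I • v) = -(Complex.I • f v))
    (c : ℂ) (v : V) : f (c • v) = starRingEnd ℂ c • f v := by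
  have h : ∀ (r : ℝ) (g : G), (r : ℂ) • g = r • g := fun r g => algebraMap_smul ℂ r g
  have hc : starRingEnd ℂ c = c.re - c.im * Complex.I := by
    apply Complex.ext <;> simp
  conv_lhs => rw [← Complex.re_add_im c]
  rw [hc]
  simp only [add_smul, sub_smul, mul_smul, map_add, Complex.coe_smul, map_smul, hf, h]
  module

/-- Applying an alternating map to a vector family with one slot replaced. -/
theorem map_update_eq_cons {k : ℕ} (α : V [⋀^Fin (k + 1)]→L[ℝ] G) (v : Fin (k + 1) → V)
    (j : Fin (k + 1)) (w : V) :
    α (Function.update v j w) = (-1) ^ (j : ℕ) • α (Matrix.vecCons w (j.removeNth v)) := by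
  rw [← map_insertNth, Fin.insertNth_removeNth]

/-- The value of `α` with the `(1,0)`-vector belonging to `w` in the `j`-th slot. -/
def slotValue {k : ℕ} (α : (Fin k → V) → G) (v : Fin k → V) (j : Fin k) (w : V) : G :=
  (1 / 2 : ℂ) • (α (Function.update v j w) - Complex.I • α (Function.update v j (Complex.I • w)))

theorem asLinearMap_apply (φ : V [⋀^Fin 1]→L[ℝ] V) (v : V) : asLinearMap φ v = φ (fun _ => v) :=
  rfl

theorem wedgeOne_apply {k : ℕ} (φ : V [⋀^Fin 1]→L[ℝ] V) (K : V →L[ℝ] (V [⋀^Fin k]→L[ℝ] G))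
    (v : Fin (k + 1) → V) :
    wedgeOne φ K v = ∑ j : Fin (k + 1), (-1) ^ (j : ℕ) •
      K (asLinearMap φ (v j)) (j.removeNth v) := by
  rw [wedgeOne, alternatizeUncurryFin_apply]; rfl

/-- The alternation sign `(-1)^j` is exactly the sign of moving slot `j` to the front, so
contraction becomes a sign-free sum of substitutions of `φ (v j)` in slot `j`. Commutativity and
nilpotency are read off from this form. -/
theorem contractOne_apply {k : ℕ} (φ : V [⋀^Fin 1]→L[ℝ] V) (α : V [⋀^Fin k]→L[ℝ] G)
    (v : Fin k → V) :
    contractOne φ α v = ∑ j, slotValue α v j (asLinearMap φ (v j)) := by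
  cases k with
  | zero => simp [contractOne]
  | succ k =>
    rw [contractOne, wedgeOne_apply]
    refine Finset.sum_congr rfl fun j _ => ?_
    simp only [slotValue, map_update_eq_cons, linPart_apply, ContinuousAlternatingMap.smul_apply,
      ContinuousAlternatingMap.sub_apply, curryLeft_apply_apply]
    rw [smul_comm, smul_sub, smul_comm _ Complex.I]

/-- `linPart` as a continuous linear map. -/
def linPartL (V G : Type*) [NormedAddCommGroup V] [NormedSpace ℂ V] [NormedAddCommGroup G]
    [NormedSpace ℝ G] [NormedSpace ℂ G] [SMulCommClass ℝ ℂ G] :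
    (V →L[ℝ] G) →L[ℝ] (V →L[ℝ] G) :=
  (1 / 2 : ℂ) • (ContinuousLinearMap.id ℝ _ -
    Complex.I • (ContinuousLinearMap.compL ℝ V V G).flip (mulI V))

/-- `wedgeOne` as a continuous bilinear map. -/
def wedgeOneL (V G : Type*) [NormedAddCommGroup V] [NormedSpace ℂ V] [NormedAddCommGroup G]
    [NormedSpace ℝ G] (k : ℕ) :
    (V →L[ℝ] (V [⋀^Fin k]→L[ℝ] G)) →L[ℝ] (V [⋀^Fin 1]→L[ℝ] V) →L[ℝ] (V [⋀^Fin (k + 1)]→L[ℝ] G) :=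
  ((alternatizeUncurryFinCLM ℝ V G).postcomp (V [⋀^Fin 1]→L[ℝ] V)).comp
    ((asLinearMap.precomp (V →L[ℝ] V [⋀^Fin k]→L[ℝ] G)).comp
      (ContinuousLinearMap.compL ℝ V V (V [⋀^Fin k]→L[ℝ] G)))

theorem wedgeOneL_apply {k : ℕ} (φ : V [⋀^Fin 1]→L[ℝ] V) (K : V →L[ℝ] (V [⋀^Fin k]→L[ℝ] G)) :
    wedgeOneL V G k K φ = wedgeOne φ K := rfl

/-- `contractOne` as a continuous bilinear map. -/
def contractOneL (V G : Type*) [NormedAddCommGroup V] [NormedSpace ℂ V] [NormedAddCommGroup G]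
    [NormedSpace ℝ G] [NormedSpace ℂ G] [SMulCommClass ℝ ℂ G] : (k : ℕ) →
    ((V [⋀^Fin k]→L[ℝ] G) →L[ℝ] (V [⋀^Fin 1]→L[ℝ] V) →L[ℝ] (V [⋀^Fin k]→L[ℝ] G))
  | 0 => 0
  | k + 1 => (wedgeOneL V G k).comp ((linPartL V (V [⋀^Fin k]→L[ℝ] G)).comp
      (curryLeftLI : (V [⋀^Fin (k + 1)]→L[ℝ] G) →ₗᵢ[ℝ] _).toContinuousLinearMap)

theorem contractOneL_apply {k : ℕ} (φ : V [⋀^Fin 1]→L[ℝ] V) (α : V [⋀^Fin k]→L[ℝ] G) :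
    contractOneL V G k α φ = contractOne φ α := by
  cases k <;> rfl

theorem contractOne_smul {k : ℕ} (φ : V [⋀^Fin 1]→L[ℝ] V) (c : ℂ) (α : V [⋀^Fin k]→L[ℝ] G) :
    contractOne φ (c • α) = c • contractOne φ α := by
  ext v
  simp only [contractOne_apply, ContinuousAlternatingMap.smul_apply, Finset.smul_sum]
  refine Finset.sum_congr rfl fun j _ => ?_
  simp only [slotValue, ContinuousAlternatingMap.smul_apply]
  module

theorem contractOne_add {k : ℕ} (φ : V [⋀^Fin 1]→L[ℝ] V) (α β : V [⋀^Fin k]→L[ℝ] G) :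
    contractOne φ (α + β) = contractOne φ α + contractOne φ β := by
  simp only [← contractOneL_apply, map_add, _root_.add_apply]

/-- Holds because only the `(1,0)`-part of the substituted vector enters. It lets `linPart` and
`antiPart` pass from `i_{φ}` to the derivative of `φ`. -/
theorem smul_contractOne {k : ℕ} (φ : V [⋀^Fin 1]→L[ℝ] V) (c : ℂ) (α : V [⋀^Fin k]→L[ℝ] G)
    [IsScalarTower ℝ ℂ G] :
    contractOne (c • φ) α = c • contractOne φ α := by
  cases k with
  | zero => simp [contractOne]
  | succ k =>
    ext v
    simp only [contractOne, ContinuousAlternatingMap.smul_apply, wedgeOne_apply, Finset.smul_sum]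
    refine Finset.sum_congr rfl fun j _ => ?_
    rw [asLinearMap_apply, ContinuousAlternatingMap.smul_apply, map_complex_smul_of_I _ (linPart_I_smul _),
      ContinuousAlternatingMap.smul_apply, smul_comm, asLinearMap_apply]

/-- The contraction with a fixed one-covector is a derivation over exterior multiplication. -/
theorem contractOne_alternatizeUncurryFin {k : ℕ} (φ : V [⋀^Fin 1]→L[ℝ] V)
    (K : V →L[ℝ] (V [⋀^Fin k]→L[ℝ] G)) :
    contractOne φ (alternatizeUncurryFin K) =
      alternatizeUncurryFin (((contractOneL V G k).flip φ).comp K) + wedgeOne φ (linPart K) := by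
  rw [add_comm (alternatizeUncurryFin _)]
  ext v
  have key : ∀ j : Fin (k + 1),
      slotValue (alternatizeUncurryFin K) v j (asLinearMap φ (v j)) =
        ∑ a : Fin (k + 1), (-1) ^ (a : ℕ) • (1 / 2 : ℂ) •
          (K (Function.update v j (asLinearMap φ (v j)) a)
              (a.removeNth (Function.update v j (asLinearMap φ (v j)))) -
            Complex.I • K (Function.update v j (Complex.I • asLinearMap φ (v j)) a)
              (a.removeNth (Function.update v j (Complex.I • asLinearMap φ (v j))))) := by
    intro j
    simp only [slotValue, alternatizeUncurryFin_apply, Finset.smul_sum, ← Finset.sum_sub_distrib]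
    refine Finset.sum_congr rfl fun a _ => ?_
    rw [smul_comm _ (1 / 2 : ℂ), smul_sub _ (K _ _), smul_comm _ Complex.I]
  rw [contractOne_apply, Finset.sum_congr rfl fun j _ => key j, Finset.sum_comm,
    ContinuousAlternatingMap.add_apply,
    alternatizeUncurryFin_apply, wedgeOne_apply, ← Finset.sum_add_distrib]
  refine Finset.sum_congr rfl fun a _ => ?_
  -- Here `a` is the slot fed to `K` and `j` the slot hit by `φ`. The term `j = a` gives `φ ∧
  -- linPart K`; the terms `j ≠ a` contract `K (v a)` itself.
  rw [← Finset.smul_sum, ← smul_add, Fin.sum_univ_succAbove _ a]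
  congr 1
  congr 1
  · simp only [Function.update_self, Fin.removeNth_update, linPart_apply,
      ContinuousAlternatingMap.smul_apply, ContinuousAlternatingMap.sub_apply]
  · simp only [ContinuousLinearMap.comp_apply, ContinuousLinearMap.flip_apply, contractOneL_apply,
      contractOne_apply]
    refine Finset.sum_congr rfl fun b _ => ?_
    simp only [slotValue, Fin.removeNth_update_succAbove,
      Function.update_of_ne (Fin.ne_succAbove a b)]
    rfl

/-- Currying the alternation of `L` gives the antisymmetrization `f - f.flip` of `f a b = M (L a
b)`. Double alternation `A` kills the symmetric `f + f.flip`, so `A (f - f.flip) = 2 A f`, which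
cancels the factor `1/2` in `wedgeTwo`. -/
theorem wedgeTwo_alternatizeUncurryFin {k : ℕ} (L : V →L[ℝ] (V [⋀^Fin 1]→L[ℝ] V))
    (M : V →L[ℝ] (V [⋀^Fin k]→L[ℝ] G)) :
    alternatizeUncurryFin ((wedgeOneL V G k M).comp L) = wedgeTwo (alternatizeUncurryFin L) M := by
  set f : V →L[ℝ] V →L[ℝ] (V [⋀^Fin k]→L[ℝ] G) :=
    (ContinuousLinearMap.compL ℝ V V (V [⋀^Fin k]→L[ℝ] G) M).comp (asLinearMap.comp L) with hf
  have h1 : (wedgeOneL V G k M).comp L = (alternatizeUncurryFinCLM ℝ V G).comp f := rfl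
  have h2 : (ContinuousLinearMap.compL ℝ V V (V [⋀^Fin k]→L[ℝ] G) M).comp
      (asLinearMap.comp (alternatizeUncurryFin L).curryLeft) = f - f.flip := by
    ext1 a
    ext1 b
    simp only [hf, ContinuousLinearMap.comp_apply, ContinuousLinearMap.compL_apply,
      asLinearMap_apply, curryLeft_apply_apply, alternatizeUncurryFin_apply, _root_.sub_apply,
      ContinuousLinearMap.flip_apply, ← map_sub]
    congr 1
    have e0 : Fin.removeNth 0 (Matrix.vecCons a fun _ : Fin 1 => b) = fun _ => b := by
      ext i; fin_cases i; rfl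
    have e1 : Fin.removeNth 1 (Matrix.vecCons a fun _ : Fin 1 => b) = fun _ => a := by
      ext i; fin_cases i; rfl
    rw [Fin.sum_univ_two, e0, e1]
    simp [sub_eq_add_neg]
  let A : (V →L[ℝ] V →L[ℝ] (V [⋀^Fin k]→L[ℝ] G)) →L[ℝ] (V [⋀^Fin (k + 2)]→L[ℝ] G) :=
    (alternatizeUncurryFinCLM ℝ V G).comp ((alternatizeUncurryFinCLM ℝ V G).postcomp V)
  have h3 : A (f + f.flip) = 0 :=
    alternatizeUncurryFin_alternatizeUncurryFinCLM_comp_of_symmetric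
      fun x y => add_comm (f x y) (f y x)
  rw [map_add, ← eq_neg_iff_add_eq_zero] at h3
  rw [wedgeTwo, h2, h1]
  have h4 : A (f - f.flip) = A f - A f.flip := A.map_sub f f.flip
  change A f = (1 / 2 : ℝ) • A (f - f.flip)
  rw [h4, h3]
  module

/-- Reduces contraction with a two-form to an alternated family of contractions with one-forms, so
the commutation rules for two-forms follow from those for one-forms. -/
theorem contractTwo_alternatizeUncurryFin {k : ℕ} (L : V →L[ℝ] (V [⋀^Fin 1]→L[ℝ] V))
    (α : V [⋀^Fin k]→L[ℝ] G) :
    alternatizeUncurryFin ((contractOneL V G k α).comp L) =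
      contractTwo (alternatizeUncurryFin L) α := by
  cases k with
  | zero => simp [contractOneL, contractTwo, ← alternatizeUncurryFinCLM_apply]
  | succ k => exact wedgeTwo_alternatizeUncurryFin L _

end Algebra

/-! ### Commutativity and nilpotency of the contractions -/

section Slots

variable {V : Type*} [NormedAddCommGroup V] [NormedSpace ℂ V]
variable {G : Type*} [NormedAddCommGroup G] [NormedSpace ℝ G] [NormedSpace ℂ G]
  [SMulCommClass ℝ ℂ G]

/-- The substitution of the `(1,0)`-part of `φ (v j)` in the `j`-th slot of a multilinear map. -/
def slotOp {k : ℕ} (φ : V →ₗ[ℝ] V) (j : Fin k) :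
    Module.End ℂ (MultilinearMap ℝ (fun _ : Fin k => V) G) where
  toFun α := (1 / 2 : ℂ) •
    (α.compLinearMap (Function.update (fun _ => LinearMap.id) j φ) -
      Complex.I • α.compLinearMap (Function.update (fun _ => LinearMap.id) j
        (Complex.I • φ)))
  map_add' α β := by
    ext v
    simp only [_root_.smul_apply, _root_.sub_apply, _root_.add_apply,
      MultilinearMap.compLinearMap_apply]
    module
  map_smul' c α := by
    ext v
    simp only [_root_.smul_apply, _root_.sub_apply,
      MultilinearMap.compLinearMap_apply, RingHom.id_apply]
    module

theorem update_id_apply {k : ℕ} (φ : V →ₗ[ℝ] V) (j : Fin k) (v : Fin k → V) :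
    (fun i => (Function.update (fun _ => LinearMap.id) j φ : Fin k → V →ₗ[ℝ] V) i (v i)) =
      Function.update v j (φ (v j)) := by
  ext i
  by_cases h : i = j
  · subst h; simp
  · simp [h]

theorem slotOp_apply {k : ℕ} (φ : V →ₗ[ℝ] V) (j : Fin k)
    (α : MultilinearMap ℝ (fun _ : Fin k => V) G) (v : Fin k → V) :
    slotOp φ j α v = slotValue α v j (φ (v j)) := by
  simp only [slotOp, LinearMap.coe_mk, AddHom.coe_mk, _root_.smul_apply,
    _root_.sub_apply, MultilinearMap.compLinearMap_apply, update_id_apply, slotValue,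
    LinearMap.smul_apply]

/-- After substituting the conjugate-linear `ψ`, slot `j` is conjugate-linear, and the second
substitution takes its complex-linear part, which is zero. Invariantly, `∂_i` contracts a
`(0,1)`-form to zero. -/
theorem slotOp_mul_self {k : ℕ} {φ ψ : V →ₗ[ℝ] V}
    (hψ : ∀ v, ψ (Complex.I • v) = -(Complex.I • ψ v)) (j : Fin k) :
    slotOp φ j * slotOp (G := G) ψ j = 0 := by
  ext α v
  simp only [Module.End.mul_apply, slotOp_apply, slotValue, Function.update_self,
    Function.update_idem, hψ, MultilinearMap.map_update_neg, smul_neg, smul_smul, Complex.I_mul_I,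
    neg_smul, one_smul, neg_neg, LinearMap.zero_apply, _root_.zero_apply]
  match_scalars
  · linear_combination (1 / 4 : ℂ) * Complex.I_mul_I
  · ring

/-- Substitutions in different slots are independent; in the same slot both products vanish. -/
theorem slotOp_commute {k : ℕ} {φ ψ : V →ₗ[ℝ] V}
    (hφ : ∀ v, φ (Complex.I • v) = -(Complex.I • φ v))
    (hψ : ∀ v, ψ (Complex.I • v) = -(Complex.I • ψ v)) (i j : Fin k) :
    Commute (slotOp (G := G) φ i) (slotOp ψ j) := by
  by_cases h : i = j
  · subst h
    rw [Commute, SemiconjBy, slotOp_mul_self hψ, slotOp_mul_self hφ]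
  · refine LinearMap.ext fun α => MultilinearMap.ext fun v => ?_
    simp only [Module.End.mul_apply, slotOp_apply, slotValue, Function.update_of_ne h,
      Function.update_of_ne (Ne.symm h), Function.update_comm h]
    module

/-- The contraction, on the underlying multilinear maps. -/
theorem toMultilinearMap_contractOne {k : ℕ} (φ : V [⋀^Fin 1]→L[ℝ] V) (α : V [⋀^Fin k]→L[ℝ] G) :
    (contractOne φ α).toMultilinearMap =
      (∑ j, slotOp (G := G) (asLinearMap φ : V →ₗ[ℝ] V) j) α.toMultilinearMap := by
  ext v
  rw [LinearMap.sum_apply, _root_.sum_apply]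
  simp only [slotOp_apply]
  exact contractOne_apply φ α v

theorem eq_of_toMultilinearMap_eq {k : ℕ} {α β : V [⋀^Fin k]→L[ℝ] G}
    (h : α.toMultilinearMap = β.toMultilinearMap) : α = β := by
  ext v
  exact congrArg (fun f : MultilinearMap ℝ (fun _ : Fin k => V) G => f v) h

theorem asLinearMap_I_smul {φ : V [⋀^Fin 1]→L[ℝ] V} (hφ : IsOfType 0 1 φ) (v : V) :
    asLinearMap φ (Complex.I • v) = -(Complex.I • asLinearMap φ v) := by
  rw [asLinearMap_apply, asLinearMap_apply, hφ]; simp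

theorem contractOne_comm {k : ℕ} {φ ψ : V [⋀^Fin 1]→L[ℝ] V} (hφ : IsOfType 0 1 φ)
    (hψ : IsOfType 0 1 ψ) (α : V [⋀^Fin k]→L[ℝ] G) :
    contractOne φ (contractOne ψ α) = contractOne ψ (contractOne φ α) := by
  apply eq_of_toMultilinearMap_eq
  simp only [toMultilinearMap_contractOne, ← Module.End.mul_apply]
  congr 1
  exact Commute.sum_left _ _ _ fun i _ => Commute.sum_right _ _ _ fun j _ =>
    slotOp_commute (asLinearMap_I_smul hφ) (asLinearMap_I_smul hψ) i j

/-- By pigeonhole, a product of `s.card + 1` commuting factors repeats one of them; the induction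
lets each new square-zero summand raise the exponent by one. -/
theorem sum_pow_eq_zero_of_sq_eq_zero {R ι : Type*} [Ring R] (s : Finset ι) (f : ι → R)
    (hc : ∀ i j, Commute (f i) (f j)) (hf : ∀ i, f i * f i = 0) :
    (∑ i ∈ s, f i) ^ (s.card + 1) = 0 := by
  classical
  induction s using Finset.induction_on with
  | empty => simp
  | insert a s ha ih =>
    rw [Finset.sum_insert ha, Finset.card_insert_of_notMem ha]
    exact Commute.add_pow_eq_zero_of_add_le_succ_of_pow_eq_zero
      (Commute.sum_right _ _ _ fun j _ => hc a j) (m := 2) (by rw [sq, hf]) ih (by omega)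

theorem contractOne_iterate {k : ℕ} {φ : V [⋀^Fin 1]→L[ℝ] V} (hφ : IsOfType 0 1 φ)
    (α : V [⋀^Fin k]→L[ℝ] G) : (contractOne φ)^[k + 1] α = 0 := by
  have h : ∀ m, ((contractOne φ)^[m] α).toMultilinearMap =
      ((∑ j, slotOp (G := G) (asLinearMap φ : V →ₗ[ℝ] V) j) ^ m) α.toMultilinearMap := by
    intro m
    induction m with
    | zero => rfl
    | succ m ih =>
      rw [Function.iterate_succ_apply', toMultilinearMap_contractOne, ih, pow_succ']; rfl
  apply eq_of_toMultilinearMap_eq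
  have := sum_pow_eq_zero_of_sq_eq_zero Finset.univ
    (fun j : Fin k => slotOp (G := G) (asLinearMap φ : V →ₗ[ℝ] V) j)
    (slotOp_commute (asLinearMap_I_smul hφ) (asLinearMap_I_smul hφ))
    (slotOp_mul_self (asLinearMap_I_smul hφ))
  rw [Finset.card_fin] at this
  rw [h, this]
  rfl

/-! ### Pointwise commutators -/

/-- Move `i_φ` through the alternation of `u ↦ i_{L u} α`: it commutes with each `i_{L u}`, and the
only defect comes from the complex-linear dependence on `u`. -/
theorem contractTwo_contractOne [IsScalarTower ℝ ℂ G] {k : ℕ} {φ : V [⋀^Fin 1]→L[ℝ] V}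
    (hφ : IsOfType 0 1 φ)
    (L : V →L[ℝ] (V [⋀^Fin 1]→L[ℝ] V)) (hL : ∀ v, IsOfType 0 1 (L v)) (α : V [⋀^Fin k]→L[ℝ] G) :
    contractTwo (alternatizeUncurryFin L) (contractOne φ α) =
      contractOne φ (contractTwo (alternatizeUncurryFin L) α) -
        wedgeOne φ ((contractOneL V G k α).comp (linPart L)) := by
  rw [← contractTwo_alternatizeUncurryFin, ← contractTwo_alternatizeUncurryFin,
    contractOne_alternatizeUncurryFin]
  have h1 : ((contractOneL V G k).flip φ).comp ((contractOneL V G k α).comp L) =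
      (contractOneL V G k (contractOne φ α)).comp L := by
    ext1 v
    simp only [ContinuousLinearMap.comp_apply, ContinuousLinearMap.flip_apply, contractOneL_apply]
    exact contractOne_comm hφ (hL v) α
  have h2 : linPart ((contractOneL V G k α).comp L) = (contractOneL V G k α).comp (linPart L) :=
    linPart_comp _ (fun c g => by simp only [contractOneL_apply, smul_contractOne]) L
  rw [h1, h2, add_sub_cancel_right]

/-- `[i_ψ, i_φ] = 0` for `ψ` of type `(0,2)`. -/
theorem contractTwo_contractOne_of_linPart_eq_zero [IsScalarTower ℝ ℂ G] {k : ℕ}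
    {φ : V [⋀^Fin 1]→L[ℝ] V} (hφ : IsOfType 0 1 φ)
    (L : V →L[ℝ] (V [⋀^Fin 1]→L[ℝ] V)) (hL : ∀ v, IsOfType 0 1 (L v)) (hL' : linPart L = 0)
    (α : V [⋀^Fin k]→L[ℝ] G) :
    contractTwo (alternatizeUncurryFin L) (contractOne φ α) =
      contractOne φ (contractTwo (alternatizeUncurryFin L) α) := by
  rw [contractTwo_contractOne hφ L hL, hL', ContinuousLinearMap.comp_zero]
  simp [wedgeOne, ← alternatizeUncurryFinCLM_apply]

theorem linPart_comp_asLinearMap {φ : V [⋀^Fin 1]→L[ℝ] V} (hφ : IsOfType 0 1 φ)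
    (L : V →L[ℝ] G) : linPart ((linPart L).comp (asLinearMap φ)) = 0 := by
  apply linPart_eq_zero
  intro v
  simp only [ContinuousLinearMap.comp_apply, asLinearMap_I_smul hφ, map_neg, linPart_I_smul]

/-- `φ ∧ i_φ K = i_φ (φ ∧ K)` for a complex-linear family `K`. -/
theorem wedgeOne_contractOne {k : ℕ} {φ : V [⋀^Fin 1]→L[ℝ] V} (hφ : IsOfType 0 1 φ)
    (K : V →L[ℝ] (V [⋀^Fin k]→L[ℝ] G)) :
    wedgeOne φ (((contractOneL V G k).flip φ).comp (linPart K)) =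
      contractOne φ (wedgeOne φ (linPart K)) := by
  rw [wedgeOne, wedgeOne, contractOne_alternatizeUncurryFin, linPart_comp_asLinearMap hφ, wedgeOne,
    ContinuousLinearMap.zero_comp, ← alternatizeUncurryFinCLM_apply (0 : V →L[ℝ] _), _root_.map_zero,
    add_zero, ContinuousLinearMap.comp_assoc]

theorem wedgeOne_comp_contractOneL {k : ℕ} (φ : V [⋀^Fin 1]→L[ℝ] V)
    (L : V →L[ℝ] (V [⋀^Fin 1]→L[ℝ] V)) (α : V [⋀^Fin k]→L[ℝ] G) :
    wedgeOne φ ((contractOneL V G k α).comp L) = contractTwo (wedgeOne φ L) α := by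
  rw [wedgeOne, wedgeOne, ContinuousLinearMap.comp_assoc, contractTwo_alternatizeUncurryFin]

end Slots

/-! ### Bidegrees and vanishing above the complex dimension -/

section Types

variable {V : Type*} [NormedAddCommGroup V] [NormedSpace ℂ V]
variable {G : Type*} [NormedAddCommGroup G] [NormedSpace ℝ G] [NormedSpace ℂ G]
  [SMulCommClass ℝ ℂ G] [IsScalarTower ℝ ℂ G]

/-- For `|c| = 1` equality would mean `c ^ d = 1` with `d = p - (m + q)`; the choice `c = exp (π i /
d)` has `c ^ d = -1`. -/
theorem exists_unit_pow_ne {p q m : ℕ} (h : p ≠ m + q) :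
    ∃ c : ℂ, c * starRingEnd ℂ c = 1 ∧ c ^ p * starRingEnd ℂ c ^ q ≠ c ^ m := by
  set d : ℤ := p - (m + q) with hd
  have hd0 : (d : ℂ) ≠ 0 := by
    rw [Int.cast_ne_zero]; omega
  refine ⟨Complex.exp ((Real.pi / d : ℝ) * Complex.I), ?_, fun hc => ?_⟩
  · rw [Complex.mul_conj, Complex.normSq_eq_norm_sq, Complex.norm_exp_ofReal_mul_I]; simp
  · set c := Complex.exp ((Real.pi / d : ℝ) * Complex.I) with hcdef
    have hc0 : c ≠ 0 := Complex.exp_ne_zero _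
    have hu : starRingEnd ℂ c * c = 1 := by
      rw [mul_comm, Complex.mul_conj, Complex.normSq_eq_norm_sq, Complex.norm_exp_ofReal_mul_I]
      simp
    have h1 : c ^ p = c ^ (m + q) := by
      rw [pow_add, ← hc, mul_assoc, ← mul_pow, hu, one_pow, mul_one]
    have h2 : c ^ d = 1 := by
      rw [hd, zpow_sub₀ hc0, ← Nat.cast_add, zpow_natCast, zpow_natCast, h1,
        div_self (pow_ne_zero _ hc0)]
    have h3 : c ^ d = -1 := by
      rw [hcdef, ← Complex.exp_int_mul, ← Complex.exp_pi_mul_I]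
      congr 1
      push_cast
      field_simp
    rw [h3] at h2
    norm_num at h2

/-- A covector which is homogeneous of bidegree `(p, q)` under unit complex numbers. -/
def IsUnitType {k : ℕ} (p q : ℕ) (α : V [⋀^Fin k]→L[ℝ] G) : Prop :=
  ∀ c : ℂ, c * starRingEnd ℂ c = 1 → ∀ v : Fin k → V,
    α (fun i => c • v i) = (c ^ p * (starRingEnd ℂ c) ^ q) • α v

/-- Filling a slot with a `(0,1)`-vector removes a factor `conj c`, which on the unit circle is the
same as adding a factor `c`. Raising `p` instead of lowering `q` avoids subtraction and any case
distinction on `q = 0`. -/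
theorem isUnitType_antiPart_curryLeft {k p q : ℕ} {α : V [⋀^Fin (k + 1)]→L[ℝ] G}
    (hα : IsUnitType p q α) (u : V) : IsUnitType (p + 1) q (antiPart α.curryLeft u) := by
  intro c hc v
  have h1 : ∀ w : V, α (Matrix.vecCons w fun i => c • v i) =
      (c ^ p * (starRingEnd ℂ c) ^ q) • α (Matrix.vecCons (starRingEnd ℂ c • w) v) := by
    intro w
    rw [← hα c hc]
    congr 1
    ext i
    refine Fin.cases ?_ (fun i => ?_) i
    · simp [smul_smul, hc]
    · simp
  have h2 : antiPart α.curryLeft u (fun i => c • v i) =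
      (c ^ p * (starRingEnd ℂ c) ^ q) • antiPart α.curryLeft (starRingEnd ℂ c • u) v := by
    simp only [antiPart_apply, ContinuousAlternatingMap.smul_apply,
      ContinuousAlternatingMap.add_apply, curryLeft_apply_apply, h1]
    rw [smul_comm Complex.I (starRingEnd ℂ c) u]
    module
  rw [h2, map_conj_smul_of_I _ (antiPart_I_smul _), Complex.conj_conj,
    ContinuousAlternatingMap.smul_apply, smul_smul]
  congr 1
  ring

/-- An alternating map that is complex-linear in the first slot is complex multilinear. -/
def toComplexAlternating {k : ℕ} (α : V [⋀^Fin (k + 1)]→L[ℝ] G)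
    (hα : antiPart α.curryLeft = 0) : V [⋀^Fin (k + 1)]→ₗ[ℂ] G where
  toFun := α
  map_update_add' := by
    intro inst v i x y
    exact α.map_update_add v i x y
  map_update_smul' := by
    intro inst v i c x
    cases Subsingleton.elim inst (instDecidableEqFin (k + 1))
    have h : ∀ u, α.curryLeft (Complex.I • u) = Complex.I • α.curryLeft u := by
      have h0 : linPart α.curryLeft = α.curryLeft := by
        conv_rhs => rw [← linPart_add_antiPart α.curryLeft, hα, add_zero]
      intro u
      rw [← h0, linPart_I_smul]
    have h1 := map_complex_smul_of_I _ h c x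
    change α (Function.update v i (c • x)) = c • α (Function.update v i x)
    rw [map_update_eq_cons, map_update_eq_cons, ← curryLeft_apply_apply, h1,
      ContinuousAlternatingMap.smul_apply, smul_comm, curryLeft_apply_apply]
  map_eq_zero_of_eq' v i j h hij := α.map_eq_zero_of_eq v h hij

/-- A covector of bidegree `(p, q)` vanishes if `p` exceeds the complex dimension. -/
theorem IsUnitType.eq_zero [FiniteDimensional ℂ V] {k p q : ℕ} {α : V [⋀^Fin k]→L[ℝ] G}
    (hα : IsUnitType p q α) (h : 2 * Module.finrank ℂ V + q < k + p) : α = 0 := by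
  -- The bound is designed for this induction: passing to the conjugate-linear part lowers `k` and
  -- raises `p`, keeping `k + p` fixed. For `k = p + q` it just says that `p` exceeds the dimension.
  induction k generalizing p with
  | zero =>
    obtain ⟨c, hc, hne⟩ := exists_unit_pow_ne (p := p) (q := q) (m := 0) (by omega)
    ext v
    have := hα c hc v
    rw [Subsingleton.elim (fun i => c • v i) v, ← sub_eq_zero] at this
    have h2 : ((1 : ℂ) - c ^ p * (starRingEnd ℂ c) ^ q) • α v = 0 := by
      rw [sub_smul, one_smul, this]
    rw [smul_eq_zero, sub_eq_zero] at h2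
    exact h2.resolve_left fun h3 => hne (by rw [← h3, pow_zero])
  | succ k ih =>
    have h0 : antiPart α.curryLeft = 0 := by
      ext1 u
      exact ih (isUnitType_antiPart_curryLeft hα u) (by omega)
    ext v
    set β := toComplexAlternating α h0 with hβ
    change β v = 0
    -- Now `α` is complex multilinear, hence homogeneous of degree `k + 1`. Either the two
    -- homogeneities agree on the unit circle, and then the bound forces `k + 1` to exceed the
    -- dimension, or they disagree for some `c` and the value is zero.
    by_cases hp : p = (k + 1) + q
    · apply β.map_linearDependent
      intro hv
      have := hv.fintype_card_le_finrank
      rw [Fintype.card_fin] at this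
      omega
    · obtain ⟨c, hc, hne⟩ := exists_unit_pow_ne hp
      have h1 : β (fun i => c • v i) = (c ^ p * (starRingEnd ℂ c) ^ q) • β v := hα c hc v
      have h2 : β (fun i => c • v i) = c ^ (k + 1) • β v := by
        have := β.toMultilinearMap.map_smul_univ (fun _ => c) v
        rw [Finset.prod_const, Finset.card_univ, Fintype.card_fin] at this
        exact this
      rw [h2, ← sub_eq_zero, ← sub_smul, smul_eq_zero, sub_eq_zero] at h1
      exact h1.resolve_left (Ne.symm hne)

theorem isUnitType_alternatizeUncurryFin_linPart {k p q : ℕ} {K : V →L[ℝ] (V [⋀^Fin k]→L[ℝ] G)}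
    (hK : ∀ u, IsUnitType p q (K u)) : IsUnitType (p + 1) q (alternatizeUncurryFin (linPart K)) := by
  intro c hc v
  rw [alternatizeUncurryFin_apply, alternatizeUncurryFin_apply, Finset.smul_sum]
  refine Finset.sum_congr rfl fun a _ => ?_
  have h : ∀ u w, linPart K u (fun i => c • w i) =
      (c ^ p * (starRingEnd ℂ c) ^ q) • linPart K u w := by
    intro u w
    simp only [linPart_apply, ContinuousAlternatingMap.smul_apply,
      ContinuousAlternatingMap.sub_apply, hK _ c hc]
    module
  have h2 := h (c • v a) (a.removeNth v)
  rw [map_complex_smul_of_I _ (linPart_I_smul _), ContinuousAlternatingMap.smul_apply,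
    ContinuousAlternatingMap.smul_apply, smul_smul] at h2
  rw [map_complex_smul_of_I _ (linPart_I_smul _), ContinuousAlternatingMap.smul_apply]
  change (-1) ^ (a : ℕ) • c • linPart K (v a) (fun i => c • a.removeNth v i) = _
  rw [h2, smul_comm]
  congr 1
  ring

end Types

/-! ### Conjugation with an exponential -/

section Exp

variable {S W : Type*} [AddCommGroup S] [Module ℂ S] [AddCommGroup W] [Module ℂ W]

/-- A `finsum` of infinite support is `0` by default, so the exponential has its intended meaning
only once the tail is known to vanish. -/
theorem expOp_eq_sum (T : W → W) (w : W) {n : ℕ} (h : ∀ m, n ≤ m → T^[m] w = 0) :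
    expOp T w = ∑ m ∈ Finset.range n, ((Nat.factorial m : ℂ)⁻¹) • (T^[m] w) := by
  rw [expOp]
  apply finsum_eq_sum_of_support_subset
  intro m hm
  by_contra hmn
  rw [Finset.coe_range, Set.mem_Iio, not_lt] at hmn
  exact hm (by simp [h m hmn])

theorem expOp_eq_exp (T : Module.End ℂ W) {n : ℕ} (h : T ^ n = 0) (w : W) :
    expOp T w = (∑ m ∈ Finset.range n, ((Nat.factorial m : ℂ)⁻¹) • T ^ m) w := by
  rw [expOp_eq_sum T w (n := n) fun m hm => by
    rw [← Module.End.coe_pow, pow_eq_zero_of_le hm h, LinearMap.zero_apply]]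
  simp [LinearMap.sum_apply, Module.End.coe_pow]

/-- The commutator `N ↦ N ∘ t - T ∘ N`. -/
def commOp (t : Module.End ℂ S) (T : Module.End ℂ W) : (S →ₗ[ℂ] W) →ₗ[ℂ] (S →ₗ[ℂ] W) :=
  (LinearMap.llcomp ℂ S S W).flip t - LinearMap.llcomp ℂ S W W T

theorem expOp_neg_add (T : Module.End ℂ W) {n : ℕ} (hT : T ^ n = 0) (v w : W) :
    expOp (fun w => -T w) (v + w) = expOp (fun w => -T w) v + expOp (fun w => -T w) w := by
  have h : (-T) ^ n = 0 := by rw [neg_pow, hT, mul_zero]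
  have h2 := expOp_eq_exp (-T) h
  change ∀ w, expOp (fun w => -T w) w = _ at h2
  rw [h2, h2, h2, _root_.map_add]

theorem restrict_pow_eq_zero (T : Module.End ℂ W) {n : ℕ} (hT : T ^ n = 0) (p : Submodule ℂ W)
    (hp : ∀ w ∈ p, T w ∈ p) : (T.restrict hp : Module.End ℂ p) ^ n = 0 := by
  rw [Module.End.pow_restrict]
  ext w
  simp [hT]

/-- Needed because `e^{i_φ}` is defined on all forms, whereas the differential operators are linear
maps only on the submodule of smooth ones. -/
theorem coe_expOp_restrict (T : Module.End ℂ W) {n : ℕ} (hT : T ^ n = 0) (p : Submodule ℂ W)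
    (hp : ∀ w ∈ p, T w ∈ p) (w : p) :
    ((expOp (T.restrict hp) w : p) : W) = expOp T (w : W) := by
  rw [expOp_eq_exp T hT, expOp_eq_exp _ (restrict_pow_eq_zero T hT p hp)]
  simp only [LinearMap.sum_apply, LinearMap.smul_apply, Submodule.coe_sum, Submodule.coe_smul]
  refine Finset.sum_congr rfl fun m _ => congrArg _ ?_
  exact congrArg (fun f : Module.End ℂ p => (f w : W)) (Module.End.pow_restrict m hp)

/-- If the third iterated commutator of `N` with a nilpotent operator vanishes, then the
conjugate of `N` with the exponential is `N + [N, t] + [[N, t], t] / 2`. -/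
theorem expOp_neg_comp_expOp (t : Module.End ℂ S) (T : Module.End ℂ W) {m n : ℕ}
    (ht : t ^ m = 0) (hT : T ^ n = 0) (N : S →ₗ[ℂ] W)
    (hN : commOp t T (commOp t T (commOp t T N)) = 0) (s : S) :
    expOp (fun w => -T w) (N (expOp t s)) =
      N s + commOp t T N s + (1 / 2 : ℂ) • commOp t T (commOp t T N) s := by
  set C₁ := commOp t T N with h₁
  set C₂ := commOp t T C₁ with h₂
  -- `A` and `B` are composition with `-T` on the left and with `t` on the right; they commute by
  -- associativity and `A + B` is `commOp t T`. So `e^A e^B = e^{A+B}` is the conjugation formula.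
  let A : Module.End ℂ (S →ₗ[ℂ] W) := -LinearMap.llcomp ℂ S W W T
  let B : Module.End ℂ (S →ₗ[ℂ] W) := (LinearMap.llcomp ℂ S S W).flip t
  have hA : ∀ (m : ℕ) (f : S →ₗ[ℂ] W), (A ^ m) f = ((-T) ^ m) ∘ₗ f := by
    intro m
    induction m with
    | zero => intro f; rfl
    | succ m ih =>
      intro f
      rw [pow_succ', Module.End.mul_apply, ih, pow_succ']
      rfl
  have hB : ∀ (m : ℕ) (f : S →ₗ[ℂ] W), (B ^ m) f = f ∘ₗ (t ^ m) := by
    intro m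
    induction m with
    | zero => intro f; rfl
    | succ m ih =>
      intro f
      rw [pow_succ', Module.End.mul_apply, ih, pow_succ]
      rfl
  have hT' : (-T) ^ n = 0 := by rw [neg_pow, hT, mul_zero]
  have hAn : A ^ n = 0 := by
    ext f; rw [hA, hT']; rfl
  have hBn : B ^ m = 0 := by
    ext f; rw [hB, ht]; simp
  have hAB : Commute A B := by
    refine LinearMap.ext fun f => LinearMap.ext fun x => ?_
    rfl
  have hD : ∀ f, (A + B) f = commOp t T f := by
    intro f; ext x
    change -T (f x) + f (t x) = f (t x) - T (f x)
    abel
  have hn : (A + B) ^ (n + m) = 0 :=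
    hAB.add_pow_eq_zero_of_add_le_succ_of_pow_eq_zero hAn hBn (by omega)
  -- `IsNilpotent.exp` has rational coefficients; `hq` converts them to the complex ones of `expOp`.
  let _ : Module ℚ (Module.End ℂ (S →ₗ[ℂ] W)) := Module.compHom _ (algebraMap ℚ ℂ)
  have hq : ∀ (m : ℕ) (x : Module.End ℂ (S →ₗ[ℂ] W)),
      ((Nat.factorial m : ℚ)⁻¹) • x = ((Nat.factorial m : ℂ)⁻¹) • x := by
    intro m x
    change algebraMap ℚ ℂ ((Nat.factorial m : ℚ)⁻¹) • x = _
    simp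
  have key := IsNilpotent.exp_add_of_commute hAB ⟨n, hAn⟩ ⟨m, hBn⟩
  -- The extra `3` guarantees that the three surviving terms can be split off the sum.
  have hn3 : (A + B) ^ (n + m + 3) = 0 := pow_eq_zero_of_le (by omega) hn
  rw [IsNilpotent.exp_eq_sum hAn, IsNilpotent.exp_eq_sum hBn, IsNilpotent.exp_eq_sum hn3] at key
  simp only [hq] at key
  have key2 := congrArg (fun f : Module.End ℂ (S →ₗ[ℂ] W) => f N s) key
  have e1 : (A + B) N = C₁ := by rw [hD, h₁]
  have e2 : (A + B) C₁ = C₂ := by rw [hD, h₂]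
  have e3 : (A + B) C₂ = 0 := by rw [hD, hN]
  have e4 : ∀ m, ((A + B) ^ (m + 3)) N = 0 := by
    intro m
    rw [pow_add, Module.End.mul_apply]
    change ((A + B) ^ m) ((A + B) ((A + B) ((A + B) N))) = 0
    rw [e1, e2, e3, _root_.map_zero]
  have hL : expOp (fun w => -T w) (N (expOp t s)) =
      ((∑ i ∈ Finset.range n, ((Nat.factorial i : ℂ)⁻¹) • A ^ i) *
        (∑ i ∈ Finset.range m, ((Nat.factorial i : ℂ)⁻¹) • B ^ i)) N s := by
    change expOp (-T : Module.End ℂ W) _ = _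
    rw [expOp_eq_exp t ht, expOp_eq_exp (-T) hT']
    simp only [Module.End.mul_apply, LinearMap.sum_apply, LinearMap.smul_apply, hA, hB,
      LinearMap.comp_apply, _root_.map_sum, map_smul]
  rw [hL]
  refine key2.symm.trans ?_
  simp only [LinearMap.sum_apply, LinearMap.smul_apply]
  rw [Finset.sum_range_succ', Finset.sum_range_succ', Finset.sum_range_succ']
  rw [Finset.sum_eq_zero fun m _ => by
    rw [show m + 1 + 1 + 1 = m + 3 from rfl, e4, LinearMap.zero_apply, smul_zero]]
  have f1 : ((A + B) ^ (0 + 1)) N = C₁ := by rw [zero_add, pow_one, e1]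
  have f2 : ((A + B) ^ (0 + 1 + 1)) N = C₂ := by
    change (A + B) ((A + B) N) = C₂
    rw [e1, e2]
  rw [f1, f2]
  simp
  abel

/-- Apply the expansion to `N = D₂ + ad D₁ + ad D₂`, for which `ad N = ad D₂ + ad² D₁` and `ad² N =
0`. With `D₁ = ∇'` and `D₂ = ∂̄` this `N` is `∂̄ - 𝓛_φ`. -/
theorem expOp_neg_comp_add_commOp (t : Module.End ℂ S) (T : Module.End ℂ W) {m n : ℕ}
    (ht : t ^ m = 0) (hT : T ^ n = 0) (D₁ D₂ : S →ₗ[ℂ] W)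
    (h₁ : commOp t T (commOp t T (commOp t T D₁)) = 0) (h₂ : commOp t T (commOp t T D₂) = 0)
    (s : S) :
    expOp (fun w => -T w) (D₂ (expOp t s) + (commOp t T D₁ (expOp t s) +
        commOp t T D₂ (expOp t s))) =
      D₂ s + commOp t T D₁ s + (2 : ℂ) • commOp t T D₂ s + commOp t T (commOp t T D₁) s := by
  have hc : commOp t T (D₂ + (commOp t T D₁ + commOp t T D₂)) =
      commOp t T D₂ + commOp t T (commOp t T D₁) := by
    rw [_root_.map_add, _root_.map_add, h₂, add_zero]
  have hc' : commOp t T (commOp t T (D₂ + (commOp t T D₁ + commOp t T D₂))) = 0 := by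
    rw [hc, _root_.map_add, h₁, h₂, add_zero]
  have h := expOp_neg_comp_expOp t T ht hT (D₂ + (commOp t T D₁ + commOp t T D₂))
    (by rw [hc', _root_.map_zero]) s
  rw [hc', hc] at h
  refine h.trans ?_
  simp only [LinearMap.add_apply, LinearMap.zero_apply]
  module

end Exp

/-! ### Coordinate changes, scalar multiplication and derivatives of typed covectors -/

section Naturality

variable {V : Type*} [NormedAddCommGroup V] [NormedSpace ℂ V]
variable {G : Type*} [NormedAddCommGroup G] [NormedSpace ℝ G] [NormedSpace ℂ G]
  [SMulCommClass ℝ ℂ G] [IsScalarTower ℝ ℂ G]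
variable {H : Type*} [NormedAddCommGroup H] [NormedSpace ℝ H] [NormedSpace ℂ H]
  [SMulCommClass ℝ ℂ H] [IsScalarTower ℝ ℂ H]

/-- Naturality of the contraction under complex-linear coordinate changes. -/
theorem contractOne_natural {k : ℕ} (φ : V [⋀^Fin 1]→L[ℝ] V) (α : V [⋀^Fin k]→L[ℝ] G)
    (A A' : V →L[ℂ] V) (hA : ∀ v, A (A' v) = v) (B : G →L[ℝ] H)
    (hB : ∀ (c : ℂ) g, B (c • g) = c • B g) :
    B.compContinuousAlternatingMap
        ((contractOne φ α).compContinuousLinearMap (A.restrictScalars ℝ)) =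
      contractOne ((A'.restrictScalars ℝ).compContinuousAlternatingMap
          (φ.compContinuousLinearMap (A.restrictScalars ℝ)))
        (B.compContinuousAlternatingMap (α.compContinuousLinearMap (A.restrictScalars ℝ))) := by
  have hu : ∀ (v : Fin k → V) j w, (A ∘ Function.update v j w) =
      Function.update (A ∘ v) j (A w) := fun v j w => Function.comp_update _ _ _ _
  ext v
  rw [contractOne_apply]
  change B (contractOne φ α (A ∘ v)) = _
  rw [contractOne_apply, _root_.map_sum]
  refine Finset.sum_congr rfl fun j _ => ?_
  change _ = (1 / 2 : ℂ) • (B (α (A ∘ Function.update v j (A' (φ fun _ => A (v j))))) -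
    Complex.I • B (α (A ∘ Function.update v j (Complex.I • A' (φ fun _ => A (v j))))))
  rw [hu, hu, _root_.map_smul A, hA, slotValue, hB, _root_.map_sub, hB]
  rfl

theorem contractOne_postcomp {k : ℕ} (φ : V [⋀^Fin 1]→L[ℝ] V) (α : V [⋀^Fin k]→L[ℝ] G)
    (B : G →L[ℝ] H) (hB : ∀ (c : ℂ) g, B (c • g) = c • B g) :
    B.compContinuousAlternatingMap (contractOne φ α) =
      contractOne φ (B.compContinuousAlternatingMap α) :=
  contractOne_natural φ α (.id ℂ V) (.id ℂ V) (fun _ => rfl) B hB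

theorem alternatizeUncurryFin_postcomp {k : ℕ} (K : V →L[ℝ] (V [⋀^Fin k]→L[ℝ] G))
    (B : G →L[ℝ] H) :
    B.compContinuousAlternatingMap (alternatizeUncurryFin K) =
      alternatizeUncurryFin
        ((ContinuousLinearMap.compContinuousAlternatingMapCLM ℝ V G H (Fin k) B).comp K) := by
  ext v
  change B (alternatizeUncurryFin K v) = _
  rw [alternatizeUncurryFin_apply, alternatizeUncurryFin_apply, _root_.map_sum]
  refine Finset.sum_congr rfl fun j _ => ?_
  rw [map_zsmul]
  rfl

theorem wedgeTwo_add {k : ℕ} (ψ χ : V [⋀^Fin 2]→L[ℝ] V) (M : V →L[ℝ] (V [⋀^Fin k]→L[ℝ] G)) :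
    wedgeTwo (ψ + χ) M = wedgeTwo ψ M + wedgeTwo χ M := by
  simp only [wedgeTwo, curryLeft_add, ContinuousLinearMap.comp_add, alternatizeUncurryFin_add,
    smul_add]

theorem smul_wedgeTwo {k : ℕ} (c : ℂ) (ψ : V [⋀^Fin 2]→L[ℝ] V)
    (M : V →L[ℝ] (V [⋀^Fin k]→L[ℝ] G)) (hM : ∀ v, M (Complex.I • v) = Complex.I • M v) :
    wedgeTwo (c • ψ) M = c • wedgeTwo ψ M := by
  have h : (ContinuousLinearMap.compL ℝ V V (V [⋀^Fin k]→L[ℝ] G) M).comp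
        (asLinearMap.comp (c • ψ).curryLeft) =
      c • (ContinuousLinearMap.compL ℝ V V (V [⋀^Fin k]→L[ℝ] G) M).comp
        (asLinearMap.comp ψ.curryLeft) := by
    ext1 a
    ext1 b
    exact map_complex_smul_of_I M hM c _
  have h2 : ∀ f : V →L[ℝ] V →L[ℝ] (V [⋀^Fin k]→L[ℝ] G),
      (alternatizeUncurryFinCLM ℝ V G).comp (c • f) =
        c • (alternatizeUncurryFinCLM ℝ V G).comp f := by
    intro f
    ext1 a
    exact alternatizeUncurryFin_smul c (f a)
  rw [wedgeTwo, h, h2, alternatizeUncurryFin_smul, smul_comm, wedgeTwo]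

theorem contractTwo_add {k : ℕ} (ψ χ : V [⋀^Fin 2]→L[ℝ] V) (α : V [⋀^Fin k]→L[ℝ] G) :
    contractTwo (ψ + χ) α = contractTwo ψ α + contractTwo χ α := by
  cases k with
  | zero => simp [contractTwo]
  | succ k => exact wedgeTwo_add _ _ _

theorem smul_contractTwo {k : ℕ} (c : ℂ) (ψ : V [⋀^Fin 2]→L[ℝ] V) (α : V [⋀^Fin k]→L[ℝ] G) :
    contractTwo (c • ψ) α = c • contractTwo ψ α := by
  cases k with
  | zero => simp [contractTwo]
  | succ k => exact smul_wedgeTwo _ _ _ (linPart_I_smul _)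

/-- For fixed `c` and `v` the homogeneity identity has constant coefficients, so it may be
differentiated in `z`. -/
theorem IsOfType.fderiv {k p q : ℕ} {f : V → (V [⋀^Fin k]→L[ℝ] G)}
    (hf : ∀ z, IsOfType p q (f z)) {z : V} (hd : DifferentiableAt ℝ f z) (u : V) :
    IsOfType p q (fderiv ℝ f z u) := by
  intro c v
  have h1 : ∀ w : Fin k → V, HasFDerivAt (fun z => f z w)
      ((ContinuousAlternatingMap.apply ℝ V G w).comp (_root_.fderiv ℝ f z)) z :=
    fun w => HasFDerivAt.comp (g := ContinuousAlternatingMap.apply ℝ V G w) z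
      (ContinuousLinearMap.hasFDerivAt _) hd.hasFDerivAt
  have h2 := h1 fun i => c • v i
  have h3 := (h1 v).const_smul (c ^ p * (starRingEnd ℂ c) ^ q)
  have h4 : (fun z => f z fun i => c • v i) =
      fun z => (c ^ p * (starRingEnd ℂ c) ^ q) • f z v := by
    ext1 z
    exact hf z c v
  rw [h4] at h2
  exact congrArg (fun f : V →L[ℝ] G => f u) (h2.unique h3)

theorem IsOfType.postcomp {k p q : ℕ} {α : V [⋀^Fin k]→L[ℝ] G} (hα : IsOfType p q α)
    (B : G →L[ℝ] H) (hB : ∀ (c : ℂ) g, B (c • g) = c • B g) :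
    IsOfType p q (B.compContinuousAlternatingMap α) := by
  intro c v
  change B (α _) = _ • B (α v)
  rw [hα, hB]

end Naturality

/-! ### Forms in holomorphic coordinates and the Leibniz rule -/

section Manifold

variable {V : Type*} [NormedAddCommGroup V] [NormedSpace ℂ V]
variable {X : Type*} [TopologicalSpace X] [ChartedSpace V X] [IsManifold 𝓘(ℂ, V) ω X]

theorem pt_self (x : X) : pt x (extChartAt 𝓘(ℂ, V) x x) = x := extChartAt_to_inv x

theorem pt_mem_source {x₀ : X} {z : V} (hz : z ∈ (extChartAt 𝓘(ℂ, V) x₀).target) :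
    pt x₀ z ∈ (extChartAt 𝓘(ℂ, V) x₀).source := (extChartAt 𝓘(ℂ, V) x₀).map_target hz

theorem tangentCoordChange_inv {x₀ y : X} (hy : y ∈ (extChartAt 𝓘(ℂ, V) x₀).source) (v : V) :
    tangentCoordChange 𝓘(ℂ, V) x₀ y y (tangentCoordChange 𝓘(ℂ, V) y x₀ y v) = v := by
  rw [tangentCoordChange_comp ⟨⟨mem_extChartAt_source y, hy⟩, mem_extChartAt_source y⟩,
    tangentCoordChange_self (mem_extChartAt_source y)]

theorem coordT_self (φ : TForm V X 1) (x : X) :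
    coordT x φ (extChartAt 𝓘(ℂ, V) x x) = φ x := by
  have h : ∀ y : X, y = x →
      ((tangentCoordChange 𝓘(ℂ, V) y x y).restrictScalars ℝ).compContinuousAlternatingMap
        ((φ y).compContinuousLinearMap
          ((tangentCoordChange 𝓘(ℂ, V) x y y).restrictScalars ℝ)) = φ x := by
    rintro y rfl
    have h1 : ∀ v, tangentCoordChange 𝓘(ℂ, V) y y y v = v := fun v =>
      tangentCoordChange_self (mem_extChartAt_source y)
    ext v
    change tangentCoordChange 𝓘(ℂ, V) y y y (φ y fun i => tangentCoordChange 𝓘(ℂ, V) y y y (v i)) = _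
    simp only [h1]
  exact h _ (pt_self x)

theorem isOfType_coordT {φ : TForm V X 1} (hφ : IsSmoothT φ) (x₀ : X) (z : V) :
    IsOfType 0 1 (coordT x₀ φ z) := by
  intro c v
  have := hφ.1 (pt x₀ z) c fun i => tangentCoordChange 𝓘(ℂ, V) x₀ (pt x₀ z) (pt x₀ z) (v i)
  change tangentCoordChange 𝓘(ℂ, V) (pt x₀ z) x₀ (pt x₀ z) (φ (pt x₀ z) fun i =>
    tangentCoordChange 𝓘(ℂ, V) x₀ (pt x₀ z) (pt x₀ z) (c • v i)) = _
  simp only [_root_.map_smul] at this ⊢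
  rw [this, _root_.map_smul]
  rfl

/-- The differential of a `T^{1,0}`-valued form in the holomorphic coordinates at `x`. -/
def diffT (φ : TForm V X 1) (x : X) : V →L[ℝ] (V [⋀^Fin 1]→L[ℝ] V) :=
  fderiv ℝ (coordT x φ) (extChartAt 𝓘(ℂ, V) x x)

theorem differentiableAt_coordT {φ : TForm V X 1} (hφ : IsSmoothT φ) (x : X) :
    DifferentiableAt ℝ (coordT x φ) (extChartAt 𝓘(ℂ, V) x x) :=
  ((hφ.2 x).contDiffAt (extChartAt_target_mem_nhds x)).differentiableAt (by simp)

theorem isOfType_diffT {φ : TForm V X 1} (hφ : IsSmoothT φ) (x : X) (u : V) :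
    IsOfType 0 1 (diffT φ x u) :=
  IsOfType.fderiv (isOfType_coordT hφ x) (differentiableAt_coordT hφ x) u

theorem IsOfType.linPart_apply {p q k : ℕ} {L : V →L[ℝ] (V [⋀^Fin k]→L[ℝ] V)}
    (hL : ∀ u, IsOfType p q (L u)) (u : V) : IsOfType p q (linPart L u) := by
  intro c v
  simp only [CpxForms.linPart_apply, ContinuousAlternatingMap.smul_apply,
    ContinuousAlternatingMap.sub_apply, hL _ c v]
  module

theorem IsOfType.antiPart_apply {p q k : ℕ} {L : V →L[ℝ] (V [⋀^Fin k]→L[ℝ] V)}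
    (hL : ∀ u, IsOfType p q (L u)) (u : V) : IsOfType p q (antiPart L u) := by
  intro c v
  simp only [CpxForms.antiPart_apply, ContinuousAlternatingMap.smul_apply,
    ContinuousAlternatingMap.add_apply, hL _ c v]
  module

variable {E : X → Type*} [∀ x, NormedAddCommGroup (E x)] [∀ x, InnerProductSpace ℂ (E x)]
variable (F : Type*) [NormedAddCommGroup F] [NormedSpace ℂ F]
  [TopologicalSpace (Bundle.TotalSpace F E)] [FiberBundle F E] [VectorBundle ℂ F E]

/-- Coordinate changes and frames are complex-linear, so they preserve `(1,0)`-parts; hence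
contraction may be computed in any chart. -/
theorem coordForm_contract (φ : TForm V X 1) {k : ℕ} (σ : EForm V E k) {x₀ : X} {z : V}
    (hz : z ∈ (extChartAt 𝓘(ℂ, V) x₀).target) :
    coordForm F x₀ (contract φ σ) z = contractOne (coordT x₀ φ z) (coordForm F x₀ σ z) :=
  contractOne_natural _ _ _ _ (tangentCoordChange_inv (pt_mem_source hz)) _
    fun c g => by simp

theorem coordForm_add {k : ℕ} (σ τ : EForm V E k) (x₀ : X) :
    coordForm F x₀ (σ + τ) = coordForm F x₀ σ + coordForm F x₀ τ := by
  ext z v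
  exact _root_.map_add ((trivializationAt F E x₀).continuousLinearMapAt ℂ (pt x₀ z)) _ _

theorem coordForm_smul {k : ℕ} (c : ℂ) (σ : EForm V E k) (x₀ : X) :
    coordForm F x₀ (c • σ) = c • coordForm F x₀ σ := by
  ext z v
  exact _root_.map_smul ((trivializationAt F E x₀).continuousLinearMapAt ℂ (pt x₀ z)) _ _

theorem ofCoord_coordForm {k : ℕ} (σ : EForm V E k) (x : X) :
    ofCoord F x (coordForm F x σ (extChartAt 𝓘(ℂ, V) x x)) = σ x := by
  -- The base point recovered from the chart is only propositionally `x`, and the fibre `E y`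
  -- depends on it; generalizing to a variable `y` permits substitution.
  have h : ∀ y : X, y = x → ofCoord F x
      ((((trivializationAt F E x).continuousLinearMapAt ℂ
        y).restrictScalars ℝ).compContinuousAlternatingMap
        ((σ y).compContinuousLinearMap
          ((tangentCoordChange 𝓘(ℂ, V) x y y).restrictScalars ℝ))) = σ x := by
    rintro y rfl
    have h1 : ∀ v, tangentCoordChange 𝓘(ℂ, V) y y y v = v := fun v =>
      tangentCoordChange_self (mem_extChartAt_source y)
    ext v
    change (trivializationAt F E y).symmL ℂ y ((trivializationAt F E y).continuousLinearMapAt ℂ y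
      (σ y fun i => tangentCoordChange 𝓘(ℂ, V) y y y (v i))) = _
    rw [Bundle.Trivialization.symmL_continuousLinearMapAt _
      (FiberBundle.mem_baseSet_trivializationAt' y)]
    simp only [h1]
  exact h _ (pt_self x)

theorem coordDomain_mem_nhds (x : X) :
    coordDomain (V := V) F E x ∈ nhds (extChartAt 𝓘(ℂ, V) x x) := by
  refine Filter.inter_mem (extChartAt_target_mem_nhds x) ?_
  refine (continuousAt_extChartAt_symm (I := 𝓘(ℂ, V)) x).preimage_mem_nhds ?_
  rw [extChartAt_to_inv]
  exact (trivializationAt F E x).open_baseSet.mem_nhds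
    (FiberBundle.mem_baseSet_trivializationAt' x)

variable {F}

theorem IsSmoothForm.differentiableAt {k : ℕ} {σ : EForm V E k} (hσ : IsSmoothForm F σ) (x : X) :
    DifferentiableAt ℝ (coordForm F x σ) (extChartAt 𝓘(ℂ, V) x x) :=
  ((hσ x).contDiffAt (coordDomain_mem_nhds F x)).differentiableAt (by simp)

theorem IsSmoothForm.contract {φ : TForm V X 1} (hφ : IsSmoothT φ) {k : ℕ} {σ : EForm V E k}
    (hσ : IsSmoothForm F σ) : IsSmoothForm F (contract φ σ) := by
  intro x₀
  refine ContDiffOn.congr (f := fun z =>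
    contractOneL V F k (coordForm F x₀ σ z) (coordT x₀ φ z)) ?_
    fun z hz => by rw [coordForm_contract F φ σ hz.1, contractOneL_apply]
  exact ((contractOneL V F k).contDiff.comp_contDiffOn (hσ x₀)).clm_apply
    ((hφ.2 x₀).mono fun z hz => hz.1)

variable (F)

/-- `ofCoord` as a continuous linear map. -/
def ofCoordL (E : X → Type*) [∀ x, NormedAddCommGroup (E x)] [∀ x, InnerProductSpace ℂ (E x)]
    [TopologicalSpace (Bundle.TotalSpace F E)] [FiberBundle F E] [VectorBundle ℂ F E]
    (V : Type*) [NormedAddCommGroup V] [NormedSpace ℂ V] (x : X) (k : ℕ) :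
    (V [⋀^Fin k]→L[ℝ] F) →L[ℝ] (V [⋀^Fin k]→L[ℝ] E x) :=
  ContinuousLinearMap.compContinuousAlternatingMapCLM ℝ V F (E x) (Fin k)
    (((trivializationAt F E x).symmL ℂ x).restrictScalars ℝ)

theorem ofCoordL_smul (x : X) {k : ℕ} (c : ℂ) (η : V [⋀^Fin k]→L[ℝ] F) :
    ofCoordL F E V x k (c • η) = c • ofCoordL F E V x k η := by
  ext v
  exact _root_.map_smul ((trivializationAt F E x).symmL ℂ x) c (η v)

theorem ofCoord_alternatizeUncurryFin (x : X) {k : ℕ} (K : V →L[ℝ] (V [⋀^Fin k]→L[ℝ] F)) :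
    (ofCoord F x (alternatizeUncurryFin K) : V [⋀^Fin (k + 1)]→L[ℝ] E x) =
      alternatizeUncurryFin ((ofCoordL F E V x k).comp K) :=
  alternatizeUncurryFin_postcomp K _

/-- The covariant derivative at `x`, with values in the covectors with values in `E x`. -/
def covDerivE {k : ℕ} (σ : EForm V E k) (x : X) : V →L[ℝ] (V [⋀^Fin k]→L[ℝ] E x) :=
  (ofCoordL F E V x k).comp (covDeriv F x σ)

theorem nabla_apply {k : ℕ} (σ : EForm V E k) (x : X) :
    nabla F σ x = alternatizeUncurryFin (covDerivE F σ x) :=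
  ofCoord_alternatizeUncurryFin F x _

theorem nablaPrime_apply {k : ℕ} (σ : EForm V E k) (x : X) :
    nablaPrime F σ x = alternatizeUncurryFin (linPart (covDerivE F σ x)) := by
  rw [covDerivE, linPart_comp _ (ofCoordL_smul F x)]
  exact ofCoord_alternatizeUncurryFin F x _

/-- The multiplication of a form with the connection form, at `x`. -/
def chernAction {k : ℕ} (E : X → Type*) [∀ x, NormedAddCommGroup (E x)]
    [∀ x, InnerProductSpace ℂ (E x)]
    [TopologicalSpace (Bundle.TotalSpace F E)] [FiberBundle F E] [VectorBundle ℂ F E] (x : X)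
    (s : V [⋀^Fin k]→L[ℝ] F) :
    V →L[ℝ] (V [⋀^Fin k]→L[ℝ] F) :=
  ((ContinuousLinearMap.compContinuousAlternatingMapCLM ℝ V F F (Fin k)).flip s).comp
      ((ContinuousLinearMap.restrictScalarsL ℂ F F ℝ ℝ).comp
        (chernForm F E x (extChartAt 𝓘(ℂ, V) x x)))

theorem covDeriv_eq {k : ℕ} (σ : EForm V E k) (x : X) :
    covDeriv F x σ = fderiv ℝ (coordForm F x σ) (extChartAt 𝓘(ℂ, V) x x) +
      chernAction F E x (coordForm F x σ (extChartAt 𝓘(ℂ, V) x x)) := rfl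

theorem chernAction_apply (x : X) {k : ℕ} (s : V [⋀^Fin k]→L[ℝ] F) (u : V) :
    chernAction F E x s u = ((chernForm F E x (extChartAt 𝓘(ℂ, V) x x)
      u).restrictScalars ℝ).compContinuousAlternatingMap s := rfl

theorem chernForm_I_smul (x : X) (z u : V) :
    chernForm F E x z (Complex.I • u) = Complex.I • chernForm F E x z u := by
  simp only [chernForm, ContinuousLinearMap.comp_apply, linPart_I_smul]
  exact _root_.map_smul (ContinuousLinearMap.compL ℂ F (F →L⋆[ℂ] ℂ) F _) _ _

/-- The Chern form has type `(1,0)`, so it drops out of the conjugate-linear part. Thus `∇'` and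
`∂̄` are two parts of one derivative, and one Leibniz rule serves both. -/
theorem dbar_apply {k : ℕ} (σ : EForm V E k) (x : X) :
    dbar F σ x = alternatizeUncurryFin (antiPart (covDerivE F σ x)) := by
  have h : antiPart (chernAction F E x (coordForm F x σ (extChartAt 𝓘(ℂ, V) x x))) = 0 := by
    apply antiPart_eq_zero
    intro u
    rw [chernAction_apply, chernForm_I_smul]
    rfl
  rw [covDerivE, antiPart_comp _ (ofCoordL_smul F x), covDeriv_eq, antiPart_add, h, add_zero]
  exact ofCoord_alternatizeUncurryFin F x _

theorem nabla_eq_add {k : ℕ} (σ : EForm V E k) : nabla F σ = nablaPrime F σ + dbar F σ := by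
  ext1 x
  rw [Pi.add_apply, nabla_apply, nablaPrime_apply, dbar_apply, ← alternatizeUncurryFin_add,
    linPart_add_antiPart]

variable {F}

theorem covDerivE_add {k : ℕ} {σ τ : EForm V E k} (hσ : IsSmoothForm F σ) (hτ : IsSmoothForm F τ)
    (x : X) : covDerivE F (σ + τ) x = covDerivE F σ x + covDerivE F τ x := by
  have h : covDeriv F x (σ + τ) = covDeriv F x σ + covDeriv F x τ := by
    rw [covDeriv_eq, covDeriv_eq, covDeriv_eq, coordForm_add,
      fderiv_add (hσ.differentiableAt x) (hτ.differentiableAt x), Pi.add_apply]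
    ext u v
    simp only [_root_.add_apply, ContinuousAlternatingMap.add_apply, chernAction_apply]
    change _ + _ + chernForm F E x _ u (_ + _) = _ + chernForm F E x _ u _ +
      (_ + chernForm F E x _ u _)
    rw [_root_.map_add]
    abel
  rw [covDerivE, h, ContinuousLinearMap.comp_add]
  rfl

theorem covDerivE_smul {k : ℕ} (c : ℂ) {σ : EForm V E k} (hσ : IsSmoothForm F σ)
    (x : X) : covDerivE F (c • σ) x = c • covDerivE F σ x := by
  have h : covDeriv F x (c • σ) = c • covDeriv F x σ := by
    rw [covDeriv_eq, covDeriv_eq, coordForm_smul,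
      fderiv_const_smul (hσ.differentiableAt x), Pi.smul_apply]
    ext u v
    simp only [_root_.add_apply, ContinuousAlternatingMap.add_apply, chernAction_apply,
      _root_.smul_apply, ContinuousAlternatingMap.smul_apply, smul_add]
    change _ + chernForm F E x _ u (c • _) = _ + c • chernForm F E x _ u _
    rw [_root_.map_smul]
  ext1 u
  simp only [covDerivE, h, ContinuousLinearMap.comp_apply, _root_.smul_apply, ofCoordL_smul]

/-- The Leibniz rule for the contraction. -/
theorem covDerivE_contract {φ : TForm V X 1} (hφ : IsSmoothT φ) {k : ℕ} {σ : EForm V E k}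
    (hσ : IsSmoothForm F σ) (x : X) :
    covDerivE F (contract φ σ) x = (contractOneL V (E x) k (σ x)).comp (diffT φ x) +
      ((contractOneL V (E x) k).flip (φ x)).comp (covDerivE F σ x) := by
  set z₀ := extChartAt 𝓘(ℂ, V) x x with hz₀
  have h1 : HasFDerivAt (coordForm F x (contract φ σ))
      ((contractOneL V F k (coordForm F x σ z₀)).comp (diffT φ x) +
        ((contractOneL V F k).flip (φ x)).comp (fderiv ℝ (coordForm F x σ) z₀)) z₀ := by
    have h3 : HasFDerivAt (coordT x φ) (diffT φ x) z₀ :=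
      (differentiableAt_coordT hφ x).hasFDerivAt
    have h4 : HasFDerivAt (coordForm F x σ) (fderiv ℝ (coordForm F x σ) z₀) z₀ :=
      (hσ.differentiableAt x).hasFDerivAt
    have h5 : HasFDerivAt (fun z => contractOneL V F k (coordForm F x σ z))
        ((contractOneL V F k).comp (fderiv ℝ (coordForm F x σ) z₀)) z₀ :=
      HasFDerivAt.comp (g := contractOneL V F k) z₀ (ContinuousLinearMap.hasFDerivAt _) h4
    have h2 := HasFDerivAt.clm_apply h5 h3
    rw [hz₀, coordT_self] at h2
    refine h2.congr_of_eventuallyEq ?_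
    filter_upwards [extChartAt_target_mem_nhds (I := 𝓘(ℂ, V)) x] with z hz
    rw [coordForm_contract F φ σ hz, ← contractOneL_apply]
  have h2 : coordForm F x (contract φ σ) z₀ = contractOne (φ x) (coordForm F x σ z₀) := by
    rw [coordForm_contract F φ σ (mem_extChartAt_target x), coordT_self]
  have hB : ∀ ψ : V [⋀^Fin 1]→L[ℝ] V, ∀ s : V [⋀^Fin k]→L[ℝ] F,
      ofCoordL F E V x k (contractOne ψ s) = contractOne ψ (ofCoordL F E V x k s) := fun ψ s =>
    contractOne_postcomp ψ s _ fun c g => _root_.map_smul ((trivializationAt F E x).symmL ℂ x) c g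
  have hs : ofCoordL F E V x k (coordForm F x σ z₀) = σ x := ofCoord_coordForm F σ x
  -- The connection form acts complex-linearly on the values in `F`, the contraction on the covector
  -- slots, so the connection term creates no defect.
  have hC : ∀ u, chernAction F E x (contractOne (φ x) (coordForm F x σ z₀)) u =
      contractOne (φ x) (chernAction F E x (coordForm F x σ z₀) u) := fun u =>
    contractOne_postcomp (φ x) _ _ fun c g => _root_.map_smul
      (chernForm F E x (extChartAt 𝓘(ℂ, V) x x) u) c g
  ext1 u
  simp only [covDerivE, covDeriv_eq, ContinuousLinearMap.comp_apply, ← hz₀, h1.fderiv, h2,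
    _root_.add_apply, ContinuousLinearMap.flip_apply, contractOneL_apply, hC, _root_.map_add, hB,
    hs, add_assoc]

end Manifold

section Manifold

variable {V : Type*} [NormedAddCommGroup V] [NormedSpace ℂ V]
variable {X : Type*} [TopologicalSpace X] [ChartedSpace V X] [IsManifold 𝓘(ℂ, V) ω X]
variable {E : X → Type*} [∀ x, NormedAddCommGroup (E x)] [∀ x, InnerProductSpace ℂ (E x)]
variable (F : Type*) [NormedAddCommGroup F] [NormedSpace ℂ F]
  [TopologicalSpace (Bundle.TotalSpace F E)] [FiberBundle F E] [VectorBundle ℂ F E]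

/-! ### Commutators with the contraction -/

variable {F}

/-- The Leibniz rule contributes `i_{∂φ}`; moving `i_φ` out of the alternation contributes `-φ ∧
∇'σ`, since all of `∇'` is complex-linear in the direction. -/
theorem nablaPrime_contract {φ : TForm V X 1} (hφ : IsSmoothT φ) {k : ℕ} {σ : EForm V E k}
    (hσ : IsSmoothForm F σ) (x : X) :
    nablaPrime F (contract φ σ) x - contract φ (nablaPrime F σ) x =
      contractTwo (alternatizeUncurryFin (linPart (diffT φ x))) (σ x) -
        wedgeOne (φ x) (linPart (covDerivE F σ x)) := by
  rw [contract, nablaPrime_apply, nablaPrime_apply, covDerivE_contract hφ hσ, linPart_add,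
    linPart_comp _ (fun c g => by simp only [contractOneL_apply, smul_contractOne]),
    linPart_comp _ (fun c g => by
      simp only [ContinuousLinearMap.flip_apply, contractOneL_apply, contractOne_smul]),
    contractOne_alternatizeUncurryFin, alternatizeUncurryFin_add,
    contractTwo_alternatizeUncurryFin, linPart_linPart]
  abel

/-- As for `∇'`, but the `φ ∧ (·)` defect disappears because a conjugate-linear map has no
complex-linear part. -/
theorem dbar_contract {φ : TForm V X 1} (hφ : IsSmoothT φ) {k : ℕ} {σ : EForm V E k}
    (hσ : IsSmoothForm F σ) :
    dbar F (contract φ σ) - contract φ (dbar F σ) = contractT2 (dbarT φ) σ := by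
  ext1 x
  rw [Pi.sub_apply, contract, dbar_apply, dbar_apply, covDerivE_contract hφ hσ, antiPart_add,
    antiPart_comp _ (fun c g => by simp only [contractOneL_apply, smul_contractOne]),
    antiPart_comp _ (fun c g => by
      simp only [ContinuousLinearMap.flip_apply, contractOneL_apply, contractOne_smul]),
    contractOne_alternatizeUncurryFin, alternatizeUncurryFin_add,
    contractTwo_alternatizeUncurryFin, linPart_antiPart, wedgeOne, ContinuousLinearMap.zero_comp,
    ← alternatizeUncurryFinCLM_apply (0 : V →L[ℝ] _), _root_.map_zero, add_zero,
    add_sub_cancel_right]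
  rfl

theorem contractT2_dbarT_contract {φ : TForm V X 1} (hφ : IsSmoothT φ) {k : ℕ}
    (σ : EForm V E k) :
    contractT2 (dbarT φ) (contract φ σ) = contract φ (contractT2 (dbarT φ) σ) := by
  ext1 x
  exact contractTwo_contractOne_of_linPart_eq_zero (hφ.1 x) _
    (IsOfType.antiPart_apply (isOfType_diffT hφ x)) (linPart_antiPart _) _

/-- Presents the bracket as the alternation of a conjugate-linear family of `(0,1)`-covectors, the
form in which contraction with it is known to commute with `i_φ`. -/
theorem bracket_self_apply (φ : TForm V X 1) (x : X) :
    bracket φ φ x = alternatizeUncurryFin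
      ((2 : ℂ) • (linPart (diffT φ x)).comp (asLinearMap (φ x))) := by
  rw [alternatizeUncurryFin_smul, two_smul]
  rfl

theorem contractT2_bracket_contract {φ : TForm V X 1} (hφ : IsSmoothT φ) {k : ℕ}
    (σ : EForm V E k) :
    contractT2 (bracket φ φ) (contract φ σ) = contract φ (contractT2 (bracket φ φ) σ) := by
  ext1 x
  simp only [contractT2, contract, bracket_self_apply]
  refine contractTwo_contractOne_of_linPart_eq_zero (hφ.1 x) _ (fun u c v => ?_) ?_ _
  · simp only [_root_.smul_apply, ContinuousAlternatingMap.smul_apply,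
      ContinuousLinearMap.comp_apply]
    rw [IsOfType.linPart_apply (isOfType_diffT hφ x) _ c v, smul_comm]
  · rw [linPart_smul, linPart_comp_asLinearMap (hφ.1 x), smul_zero]

/-- The second commutator of `∇'` with `i_φ` is `-i_{[φ, φ]}`. -/
theorem nablaPrime_contract_contract {φ : TForm V X 1} (hφ : IsSmoothT φ) {k : ℕ}
    {σ : EForm V E k} (hσ : IsSmoothForm F σ) :
    (nablaPrime F (contract φ (contract φ σ)) - contract φ (nablaPrime F (contract φ σ))) -
        contract φ (nablaPrime F (contract φ σ) - contract φ (nablaPrime F σ)) =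
      -contractT2 (bracket φ φ) σ := by
  -- The bracket arises in two equal halves: `i_{∂φ}` fails to commute with `i_φ` because `∂φ` has
  -- type `(1,1)` (`h3`), and differentiating `φ` in `φ ∧ ∇'(i_φ σ)` (`h2`) yields the other half.
  -- The remaining terms cancel.
  ext1 x
  rw [Pi.sub_apply, Pi.sub_apply, nablaPrime_contract hφ (hσ.contract hφ)]
  have h1 : contract φ (nablaPrime F (contract φ σ) - contract φ (nablaPrime F σ)) x =
      contractOne (φ x) (contractTwo (alternatizeUncurryFin (linPart (diffT φ x))) (σ x)) -
        contractOne (φ x) (wedgeOne (φ x) (linPart (covDerivE F σ x))) := by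
    rw [contract, Pi.sub_apply, nablaPrime_contract hφ hσ]
    simp only [← contractOneL_apply, _root_.map_sub, _root_.sub_apply]
  have h2 : wedgeOne (φ x) (linPart (covDerivE F (contract φ σ) x)) =
      contractTwo (wedgeOne (φ x) (linPart (diffT φ x))) (σ x) +
        contractOne (φ x) (wedgeOne (φ x) (linPart (covDerivE F σ x))) := by
    rw [covDerivE_contract hφ hσ, linPart_add,
      linPart_comp _ (fun c g => by simp only [contractOneL_apply, smul_contractOne]),
      linPart_comp _ (fun c g => by
        simp only [ContinuousLinearMap.flip_apply, contractOneL_apply, contractOne_smul]),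
      ← wedgeOne_contractOne (hφ.1 x), ← wedgeOne_comp_contractOneL, ← wedgeOneL_apply,
      _root_.map_add]
    rfl
  have h3 : contractTwo (alternatizeUncurryFin (linPart (diffT φ x))) (contract φ σ x) =
      contractOne (φ x) (contractTwo (alternatizeUncurryFin (linPart (diffT φ x))) (σ x)) -
        contractTwo (wedgeOne (φ x) (linPart (diffT φ x))) (σ x) := by
    rw [contract, contractTwo_contractOne (hφ.1 x) _
      (IsOfType.linPart_apply (isOfType_diffT hφ x)), linPart_linPart, wedgeOne_comp_contractOneL]
  have h4 : contractT2 (bracket φ φ) σ x =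
      contractTwo (wedgeOne (φ x) (linPart (diffT φ x))) (σ x) +
        contractTwo (wedgeOne (φ x) (linPart (diffT φ x))) (σ x) := by
    rw [← contractTwo_add]
    rfl
  rw [h1, h2, h3, Pi.neg_apply, h4]
  abel

/-- Coordinate derivatives and the connection term preserve the type `(n,q)`; alternating the
complex-linear part raises it to `(n+1,q)`, where every covector vanishes. -/
theorem nablaPrime_eq_zero [FiniteDimensional ℂ V] {q : ℕ}
    {σ : EForm V E (Module.finrank ℂ V + q)} (hσ : IsSmoothPQ F (Module.finrank ℂ V) q σ) :
    nablaPrime F σ = 0 := by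
  ext1 x
  have h1 : ∀ z, IsOfType (Module.finrank ℂ V) q (coordForm F x σ z) := by
    intro z
    refine IsOfType.postcomp (fun c v => ?_) _
      fun c g => _root_.map_smul ((trivializationAt F E x).continuousLinearMapAt ℂ (pt x z)) c g
    rw [compContinuousLinearMap_apply, compContinuousLinearMap_apply, ← hσ.2]
    congr 1
    ext1 i
    exact _root_.map_smul (tangentCoordChange 𝓘(ℂ, V) x (pt x z) (pt x z)) c (v i)
  have h2 : ∀ u, IsOfType (Module.finrank ℂ V) q (covDerivE F σ x u) := by
    intro u
    refine IsOfType.postcomp (fun c v => ?_) _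
      fun c g => _root_.map_smul ((trivializationAt F E x).symmL ℂ x) c g
    have h3 := IsOfType.fderiv h1 (hσ.1.differentiableAt x) u c v
    have h4 := IsOfType.postcomp (h1 (extChartAt 𝓘(ℂ, V) x x))
      ((chernForm F E x (extChartAt 𝓘(ℂ, V) x x) u).restrictScalars ℝ)
      (fun c g => _root_.map_smul (chernForm F E x (extChartAt 𝓘(ℂ, V) x x) u) c g) c v
    have h5 : covDeriv F x σ u = fderiv ℝ (coordForm F x σ) (extChartAt 𝓘(ℂ, V) x x) u +
        ((chernForm F E x (extChartAt 𝓘(ℂ, V) x x)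
          u).restrictScalars ℝ).compContinuousAlternatingMap
            (coordForm F x σ (extChartAt 𝓘(ℂ, V) x x)) := rfl
    change covDeriv F x σ u _ = _ • covDeriv F x σ u v
    rw [h5, ContinuousAlternatingMap.add_apply, h3, h4, ← smul_add]
    rfl
  rw [nablaPrime_apply]
  exact (isUnitType_alternatizeUncurryFin_linPart fun u c _ v => h2 u c v).eq_zero (by omega)

/-! ### The exponential of the contraction -/

variable (V E F) in
/-- The space of smooth `E`-valued `k`-forms. -/
def smoothForms (k : ℕ) :
    Submodule ℂ (EForm V E k) where
  carrier := {σ | IsSmoothForm F σ}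
  add_mem' hσ hτ x₀ := by
    rw [coordForm_add]
    exact (hσ x₀).add (hτ x₀)
  zero_mem' x₀ := by
    have h : coordForm F x₀ (0 : EForm V E k) = 0 := by
      have := coordForm_smul F (0 : ℂ) (0 : EForm V E k) x₀
      rwa [zero_smul, zero_smul] at this
    rw [h]
    exact contDiffOn_const
  smul_mem' c _ hσ x₀ := by
    rw [coordForm_smul]
    exact (hσ x₀).const_smul c

/-- The contraction as a linear map. -/
def contractLM (E : X → Type*) [∀ x, NormedAddCommGroup (E x)] [∀ x, InnerProductSpace ℂ (E x)]
    (φ : TForm V X 1) (k : ℕ) : Module.End ℂ (EForm V E k) where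
  toFun σ := contract φ σ
  map_add' _ _ := funext fun _ => contractOne_add _ _ _
  map_smul' c _ := funext fun _ => contractOne_smul _ c _

theorem contractLM_pow_eq_zero {φ : TForm V X 1} (hφ : IsSmoothT φ) (k : ℕ) :
    contractLM E φ k ^ (k + 1) = 0 := by
  ext1 σ
  ext1 x
  have h : ∀ m, (contractLM E φ k ^ m) σ x = (contractOne (φ x))^[m] (σ x) := by
    intro m
    induction m with
    | zero => rfl
    | succ m ih =>
      rw [pow_succ', Function.iterate_succ_apply', ← ih]
      rfl
  rw [h, contractOne_iterate (hφ.1 x)]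
  rfl

theorem contract_mem_smoothForms {φ : TForm V X 1} (hφ : IsSmoothT φ) (k : ℕ) :
    ∀ σ ∈ smoothForms V E F k, contractLM E φ k σ ∈ smoothForms V E F k :=
  fun _ hσ => IsSmoothForm.contract hφ hσ

variable (F E) in
/-- The contraction on smooth forms. -/
def contractSmooth {φ : TForm V X 1} (hφ : IsSmoothT φ) (k : ℕ) :
    Module.End ℂ (smoothForms V E F k) :=
  (contractLM E φ k).restrict (contract_mem_smoothForms hφ k)

theorem expContract_eq {φ : TForm V X 1} (hφ : IsSmoothT φ) {k : ℕ} {σ : EForm V E k}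
    (hσ : IsSmoothForm F σ) :
    expContract φ σ =
      (expOp (contractSmooth E F hφ k) ⟨σ, hσ⟩ : smoothForms V E F k) :=
  (coe_expOp_restrict (contractLM E φ k) (contractLM_pow_eq_zero hφ k) _
    (contract_mem_smoothForms hφ k) ⟨σ, hσ⟩).symm

/-- The commutator of an operator on smooth forms with the contraction. -/
def commContract {φ : TForm V X 1} (hφ : IsSmoothT φ) {k : ℕ} :
    (smoothForms V E F k →ₗ[ℂ] EForm V E (k + 1)) →ₗ[ℂ]
      (smoothForms V E F k →ₗ[ℂ] EForm V E (k + 1)) :=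
  commOp (contractSmooth E F hφ k) (contractLM E φ (k + 1))

theorem commContract_apply {φ : TForm V X 1} (hφ : IsSmoothT φ) {k : ℕ}
    (N : smoothForms V E F k →ₗ[ℂ] EForm V E (k + 1)) (σ : smoothForms V E F k) :
    commContract hφ N σ = N (contractSmooth E F hφ k σ) - contract φ (N σ) := rfl

theorem contractSmooth_pow_eq_zero {φ : TForm V X 1} (hφ : IsSmoothT φ) (k : ℕ) :
    contractSmooth E F hφ k ^ (k + 1) = 0 :=
  restrict_pow_eq_zero (contractLM E φ k) (contractLM_pow_eq_zero hφ k) (smoothForms V E F k)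
    (contract_mem_smoothForms hφ k)

theorem expNegContract_comp_expContract {φ : TForm V X 1} (hφ : IsSmoothT φ) {k : ℕ}
    (N : smoothForms V E F k →ₗ[ℂ] EForm V E (k + 1))
    (hN : commContract hφ (commContract hφ (commContract hφ N)) = 0) (σ : smoothForms V E F k) :
    expNegContract φ (N (expOp (contractSmooth E F hφ k) σ)) =
      N σ + commContract hφ N σ + (1 / 2 : ℂ) • commContract hφ (commContract hφ N) σ :=
  expOp_neg_comp_expOp (contractSmooth E F hφ k) (contractLM E φ (k + 1))
    (contractSmooth_pow_eq_zero hφ k) (contractLM_pow_eq_zero hφ (k + 1)) N hN σ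

variable (V E F) in
/-- `∇'` on smooth forms as a linear map. -/
def nablaPrimeLM (k : ℕ) : smoothForms V E F k →ₗ[ℂ] EForm V E (k + 1) where
  toFun σ := nablaPrime F (σ : EForm V E k)
  map_add' σ τ := by
    ext1 x
    simp only [Submodule.coe_add, Pi.add_apply, nablaPrime_apply,
      covDerivE_add σ.2 τ.2, linPart_add, alternatizeUncurryFin_add]
  map_smul' c σ := by
    ext1 x
    simp only [Submodule.coe_smul, Pi.smul_apply, nablaPrime_apply, RingHom.id_apply,
      covDerivE_smul c σ.2, linPart_smul, alternatizeUncurryFin_smul]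

variable (V E F) in
/-- `∂̄` on smooth forms as a linear map. -/
def dbarLM (k : ℕ) : smoothForms V E F k →ₗ[ℂ] EForm V E (k + 1) where
  toFun σ := dbar F (σ : EForm V E k)
  map_add' σ τ := by
    ext1 x
    simp only [Submodule.coe_add, Pi.add_apply, dbar_apply,
      covDerivE_add σ.2 τ.2, antiPart_add, alternatizeUncurryFin_add]
  map_smul' c σ := by
    ext1 x
    simp only [Submodule.coe_smul, Pi.smul_apply, dbar_apply, RingHom.id_apply,
      covDerivE_smul c σ.2, antiPart_smul, alternatizeUncurryFin_smul]

theorem commContract_dbarLM {φ : TForm V X 1} (hφ : IsSmoothT φ) {k : ℕ}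
    (σ : smoothForms V E F k) :
    commContract hφ (dbarLM V E F k) σ = contractT2 (dbarT φ) (σ : EForm V E k) :=
  dbar_contract hφ σ.2

theorem commContract_commContract_dbarLM {φ : TForm V X 1} (hφ : IsSmoothT φ) (k : ℕ) :
    commContract hφ (commContract hφ (dbarLM V E F k)) = 0 := by
  ext1 σ
  rw [commContract_apply, commContract_dbarLM, commContract_dbarLM, LinearMap.zero_apply,
    sub_eq_zero]
  exact contractT2_dbarT_contract hφ _

theorem commContract_commContract_nablaPrimeLM {φ : TForm V X 1} (hφ : IsSmoothT φ) {k : ℕ}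
    (σ : smoothForms V E F k) :
    commContract hφ (commContract hφ (nablaPrimeLM V E F k)) σ =
      -contractT2 (bracket φ φ) (σ : EForm V E k) :=
  nablaPrime_contract_contract hφ σ.2

/-- The second commutator is contraction with the `(0,2)`-form `-[φ,φ]`, which commutes with `i_φ`;
this is where the exponential series stops. -/
theorem commContract_iterate_nablaPrimeLM {φ : TForm V X 1} (hφ : IsSmoothT φ) (k : ℕ) :
    commContract hφ (commContract hφ (commContract hφ (nablaPrimeLM V E F k))) = 0 := by
  ext1 σ
  rw [commContract_apply, commContract_commContract_nablaPrimeLM,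
    commContract_commContract_nablaPrimeLM, LinearMap.zero_apply, sub_eq_zero]
  have h : contract φ (-contractT2 (bracket φ φ) (σ : EForm V E k)) =
      -contract φ (contractT2 (bracket φ φ) (σ : EForm V E k)) :=
    (contractLM E φ (k + 1)).map_neg _
  rw [h, ← contractT2_bracket_contract hφ]
  rfl

/-! ### The conjugation formulas -/

theorem contractT2_add (ψ χ : TForm V X 2) {k : ℕ} (σ : EForm V E k) :
    contractT2 (ψ + χ) σ = contractT2 ψ σ + contractT2 χ σ :=
  funext fun _ => contractTwo_add _ _ _

theorem smul_contractT2 (c : ℂ) (ψ : TForm V X 2) {k : ℕ} (σ : EForm V E k) :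
    contractT2 (c • ψ) σ = c • contractT2 ψ σ :=
  funext fun _ => smul_contractTwo _ _ _

theorem contractT2_sub (ψ χ : TForm V X 2) {k : ℕ} (σ : EForm V E k) :
    contractT2 (ψ - χ) σ = contractT2 ψ σ - contractT2 χ σ := by
  rw [eq_sub_iff_add_eq, ← contractT2_add, sub_add_cancel]

theorem lieD_eq_add (φ : TForm V X 1) {k : ℕ} (σ : EForm V E k) :
    lieD F φ σ = lieD10 F φ σ + lieD01 F φ σ := by
  have h : contract φ (nablaPrime F σ + dbar F σ) =
      contract φ (nablaPrime F σ) + contract φ (dbar F σ) := (contractLM E φ (k + 1)).map_add _ _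
  rw [lieD, lieD10, lieD01, nabla_eq_add, nabla_eq_add, h]
  abel

theorem lieD01_eq {φ : TForm V X 1} (hφ : IsSmoothT φ) {k : ℕ} {σ : EForm V E k}
    (hσ : IsSmoothForm F σ) : lieD01 F φ σ = -contractT2 (dbarT φ) σ := by
  rw [lieD01, ← dbar_contract hφ hσ]
  abel

theorem commContract_nablaPrimeLM {φ : TForm V X 1} (hφ : IsSmoothT φ) {k : ℕ}
    (σ : smoothForms V E F k) :
    commContract hφ (nablaPrimeLM V E F k) σ = -lieD10 F φ (σ : EForm V E k) := by
  rw [lieD10, neg_add, neg_neg, ← sub_eq_add_neg]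
  rfl

theorem exp_conj_dbar {φ : TForm V X 1} (hφ : IsSmoothT φ) {k : ℕ} {σ : EForm V E k}
    (hσ : IsSmoothForm F σ) :
    expNegContract φ (dbar F (expContract φ σ)) = dbar F σ - lieD01 F φ σ := by
  have h := expNegContract_comp_expContract hφ (dbarLM V E F k)
    (by rw [commContract_commContract_dbarLM hφ, _root_.map_zero]) ⟨σ, hσ⟩
  rw [commContract_commContract_dbarLM hφ, commContract_dbarLM, LinearMap.zero_apply, smul_zero,
    add_zero] at h
  rw [expContract_eq hφ hσ, lieD01_eq hφ hσ, sub_neg_eq_add]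
  exact h

theorem exp_conj_nablaPrime {φ : TForm V X 1} (hφ : IsSmoothT φ) {k : ℕ} {σ : EForm V E k}
    (hσ : IsSmoothForm F σ) :
    expNegContract φ (nablaPrime F (expContract φ σ)) =
      nablaPrime F σ - lieD10 F φ σ - contractT2 ((1 / 2 : ℂ) • bracket φ φ) σ := by
  have h := expNegContract_comp_expContract hφ (nablaPrimeLM V E F k)
    (commContract_iterate_nablaPrimeLM hφ k) ⟨σ, hσ⟩
  rw [commContract_commContract_nablaPrimeLM, commContract_nablaPrimeLM, smul_neg,
    ← sub_eq_add_neg, ← sub_eq_add_neg] at h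
  rw [expContract_eq hφ hσ, smul_contractT2]
  exact h

theorem expNegContract_add {φ : TForm V X 1} (hφ : IsSmoothT φ) {k : ℕ} (σ τ : EForm V E k) :
    expNegContract φ (σ + τ) = expNegContract φ σ + expNegContract φ τ :=
  expOp_neg_add (contractLM E φ k) (contractLM_pow_eq_zero hφ k) σ τ

theorem exp_conj_nabla {φ : TForm V X 1} (hφ : IsSmoothT φ) {k : ℕ} {σ : EForm V E k}
    (hσ : IsSmoothForm F σ) :
    expNegContract φ (nabla F (expContract φ σ)) =
      nabla F σ - lieD F φ σ - contractT2 ((1 / 2 : ℂ) • bracket φ φ) σ := by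
  rw [nabla_eq_add, expNegContract_add hφ, exp_conj_dbar hφ hσ, exp_conj_nablaPrime hφ hσ,
    nabla_eq_add, lieD_eq_add]
  abel

theorem exp_conj_nabla_eq_lieD10 {φ : TForm V X 1} (hφ : IsSmoothT φ) {k : ℕ} {σ : EForm V E k}
    (hσ : IsSmoothForm F σ) :
    expNegContract φ (nabla F (expContract φ σ)) =
      nabla F σ - lieD10 F φ σ + contractT2 (dbarT φ - (1 / 2 : ℂ) • bracket φ φ) σ := by
  rw [exp_conj_nabla hφ hσ, lieD_eq_add, lieD01_eq hφ hσ, contractT2_sub]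
  abel

/-- Conjugating `∂̄ - 𝓛_φ` gives `∂̄ - 𝓛^{1,0}_φ + 2 i_{∂̄φ} - i_{[φ,φ]}`, and integrability cancels
the last two terms. -/
theorem exp_conj_dbar_sub_lieD {φ : TForm V X 1} (hφ : IsSmoothT φ) {k : ℕ} {σ : EForm V E k}
    (hσ : IsSmoothForm F σ) (hint : dbarT φ = (1 / 2 : ℂ) • bracket φ φ) :
    dbar F σ - lieD10 F φ σ =
      expNegContract φ (dbar F (expContract φ σ) - lieD F φ (expContract φ σ)) := by
  have h := expOp_neg_comp_add_commOp (contractSmooth E F hφ k) (contractLM E φ (k + 1))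
    (contractSmooth_pow_eq_zero hφ k) (contractLM_pow_eq_zero hφ (k + 1))
    (nablaPrimeLM V E F k) (dbarLM V E F k) (commContract_iterate_nablaPrimeLM hφ k)
    (commContract_commContract_dbarLM hφ k) ⟨σ, hσ⟩
  have e : ∀ τ : smoothForms V E F k, lieD F φ (τ : EForm V E k) =
      -(commContract hφ (nablaPrimeLM V E F k) τ + commContract hφ (dbarLM V E F k) τ) := by
    intro τ
    rw [lieD_eq_add, commContract_nablaPrimeLM, commContract_dbarLM, lieD01_eq hφ τ.2]
    abel
  rw [expContract_eq hφ hσ, e, sub_neg_eq_add]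
  refine Eq.trans ?_ h.symm
  change _ = dbar F σ + commContract hφ (nablaPrimeLM V E F k) ⟨σ, hσ⟩ +
    (2 : ℂ) • commContract hφ (dbarLM V E F k) ⟨σ, hσ⟩ +
    commContract hφ (commContract hφ (nablaPrimeLM V E F k)) ⟨σ, hσ⟩
  rw [commContract_commContract_nablaPrimeLM, commContract_nablaPrimeLM, commContract_dbarLM, hint,
    smul_contractT2]
  module

theorem exp_conj_nabla_top [FiniteDimensional ℂ V] {φ : TForm V X 1} (hφ : IsSmoothT φ) {q : ℕ}
    {σ : EForm V E (Module.finrank ℂ V + q)} (hσ : IsSmoothPQ F (Module.finrank ℂ V) q σ) :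
    expNegContract φ (nabla F (expContract φ σ)) =
      dbar F σ - lieD10 F φ σ + contractT2 (dbarT φ - (1 / 2 : ℂ) • bracket φ φ) σ := by
  rw [exp_conj_nabla_eq_lieD10 hφ hσ.1, nabla_eq_add, nablaPrime_eq_zero hσ, zero_add]

theorem lieD10_top [FiniteDimensional ℂ V] (φ : TForm V X 1) {q : ℕ}
    {σ : EForm V E (Module.finrank ℂ V + q)} (hσ : IsSmoothPQ F (Module.finrank ℂ V) q σ) :
    lieD10 F φ σ = -nablaPrime F (contract φ σ) := by
  have h : contract φ (0 : EForm V E (Module.finrank ℂ V + q + 1)) = 0 :=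
    (contractLM E φ (Module.finrank ℂ V + q + 1)).map_zero
  rw [lieD10, nablaPrime_eq_zero hσ, h, add_zero]

end Manifold

end CpxForms

end

theorem mainTheorem4
    {V : Type*} [NormedAddCommGroup V] [NormedSpace ℂ V] [FiniteDimensional ℂ V]
    {X : Type*} [TopologicalSpace X] [ChartedSpace V X] [IsManifold 𝓘(ℂ, V) ω X]
    (F : Type*) [NormedAddCommGroup F] [NormedSpace ℂ F] [FiniteDimensional ℂ F]
    (E : X → Type*) [∀ x, NormedAddCommGroup (E x)] [∀ x, InnerProductSpace ℂ (E x)]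
    [TopologicalSpace (Bundle.TotalSpace F E)] [FiberBundle F E] [VectorBundle ℂ F E]
    [ContMDiffVectorBundle ω F E 𝓘(ℂ, V)]
    (hE : IsSmoothMetric V F E)
    (φ : TForm V X 1) (hφ : IsSmoothT φ) :
    -- on all smooth `E`-valued forms
    (∀ (k : ℕ) (σ : EForm V E k), IsSmoothForm F σ →
      expNegContract φ (nabla F (expContract φ σ)) =
          nabla F σ - lieD F φ σ - contractT2 ((1 / 2 : ℂ) • bracket φ φ) σ ∧
      expNegContract φ (nabla F (expContract φ σ)) =
          nabla F σ - lieD10 F φ σ + contractT2 (dbarT φ - (1 / 2 : ℂ) • bracket φ φ) σ ∧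
      expNegContract φ (dbar F (expContract φ σ)) = dbar F σ - lieD01 F φ σ ∧
      expNegContract φ (nablaPrime F (expContract φ σ)) =
          nablaPrime F σ - lieD10 F φ σ - contractT2 ((1 / 2 : ℂ) • bracket φ φ) σ ∧
      (dbarT φ = (1 / 2 : ℂ) • bracket φ φ →
        dbar F σ - lieD10 F φ σ =
          expNegContract φ (dbar F (expContract φ σ) - lieD F φ (expContract φ σ)))) ∧
    -- on `A^{n,q}(X, E)`, `n = dim X`
    (∀ (q : ℕ) (σ : EForm V E (Module.finrank ℂ V + q)),
      IsSmoothPQ F (Module.finrank ℂ V) q σ →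
      expNegContract φ (nabla F (expContract φ σ)) =
          dbar F σ - lieD10 F φ σ + contractT2 (dbarT φ - (1 / 2 : ℂ) • bracket φ φ) σ ∧
      expNegContract φ (nabla F (expContract φ σ)) =
          dbar F σ + nablaPrime F (contract φ σ)
            + contractT2 (dbarT φ - (1 / 2 : ℂ) • bracket φ φ) σ ∧
      (dbarT φ - (1 / 2 : ℂ) • bracket φ φ = 0 →
        expNegContract φ (nabla F (expContract φ σ)) =
          dbar F σ + nablaPrime F (contract φ σ))) := by
  have key : ∀ (q : ℕ) (σ : EForm V E (Module.finrank ℂ V + q)),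
      IsSmoothPQ F (Module.finrank ℂ V) q σ →
      expNegContract φ (nabla F (expContract φ σ)) =
        dbar F σ + nablaPrime F (contract φ σ)
          + contractT2 (dbarT φ - (1 / 2 : ℂ) • bracket φ φ) σ := fun q σ hσ => by
    rw [exp_conj_nabla_top hφ hσ, lieD10_top φ hσ, sub_neg_eq_add]
  refine ⟨fun k σ hσ => ⟨exp_conj_nabla hφ hσ, exp_conj_nabla_eq_lieD10 hφ hσ, exp_conj_dbar hφ hσ,
    exp_conj_nablaPrime hφ hσ, exp_conj_dbar_sub_lieD hφ hσ⟩,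
    fun q σ hσ => ⟨exp_conj_nabla_top hφ hσ, key q σ hσ, fun hint => ?_⟩⟩
  rw [key q σ hσ, hint]
  have h : contractT2 (0 : TForm V X 2) σ = 0 := by
    have := smul_contractT2 (0 : ℂ) (0 : TForm V X 2) σ
    rwa [zero_smul, zero_smul] at this
  rw [h, add_zero]
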